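/- Let $A:[0,\infty)\to\mathbb R^{d\times d}$ be continuous and $H:[0,\infty)\to\mathbb R^{s\times d}$ measurable, both bounded: $\sup_{t\ge0}\sup_{\|x\|=1}\|A(t)x\|<\infty$ and $\sup_{t\ge0}\sup_{\|x\|=1}\|H(t)x\|<\infty$. For $v\in\mathbb R^d$ let $\xi(t;v)$ solve $\dot\xi=A(t)\xi$, $\xi(0)=v$, and put $\lambda(v)=\limsup_{t\to\infty}\frac1t\log\|\xi(t;v)\|$ (with $\lambda(0)=-\infty$). Let $\lambda_1\ge\dots\ge\lambda_d$ be the Lyapunov exponents, i.e. the values of $\lambda$ on $\mathbb R^d\setminus\{0\}$ counted with multiplicity, so that $\#\{i:\lambda_i\le c\}=\dim\{v:\lambda(v)\le c\}$ for every $c\in\mathbb R$, and let $k$ be the number of indices $i$ with $\lambda_i\ge 0$. Let $\mathbb Q(t)\in\mathbb R^{d\times d}$ be orthogonal and solve the continuous QR equation $\dot{\mathbb Q}=\mathbb Q S$, where $S$ is skew-symmetric with $S_{ij}=(\mathbb Q^\top A\mathbb Q)_{ij}$ for $i>j$, so that $B=\mathbb Q^\top A\mathbb Q-S$ is upper triangular.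 Assume forward regularity: $\lim_{t\to\infty}\frac1t\int_0^tB_{ii}(\tau)\,d\tau$ exists for $i=1,\dots,d$. Let $Q(t)\in\mathbb R^{d\times k}$ consist of the first $k$ columns $Q_1,\dots,Q_k$ of $\mathbb Q(t)$; equivalently, $Q$ solves $\dot Q=(I-QQ^\top)AQ+Q\tilde S$ with $\tilde S$ skew-symmetric and $Q^\top AQ-\tilde S$ upper triangular. Assume that these columns belong to the non-stable directions, in the sense that $\lambda(v)\ge0$ for every non-zero $v$ in the span of the columns of $Q(0)$. Let $\tilde Q(t)\tilde R(t)=H^\top(t)H(t)Q(t)$ be the thin QR factorisation produced by the Gram–Schmidt process ($\tilde R\in\mathbb R^{k\times k}$ upper triangular, $\tilde R_{jj}\ge0$, and the $j$th column of $\tilde Q\in\mathbb R^{d\times k}$ is $0$ when $\tilde R_{jj}=0$). Call $(A,H)$ detectable if $\limsup_{t\to\infty}\frac1t\int_0^t\tilde R_{jj}(\tau)\,d\tau>0$ for every $j\le k$ with $\lim_{t\to\infty}\frac1t\int_0^tB_{jj}(\tau)\,d\tau\ge0$. For $p>0$ let $L=p\,Q\tilde Q^\top H^\top$. Let $z$ and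 $x$ solve (in the sense of Carathéodory, i.e. as integral equations) $$\dot z=A(t)z,\quad z(0)=v,\qquad y=H(t)z,\qquad \dot x=A(t)x+L(t)(y(t)-H(t)x),\quad x(0)=0,$$ and say that the error $\xi=z-x$ decays exponentially if there are $C,a>0$ such that $\|\xi(t)\|\le Ce^{-at}\|\xi(0)\|$ for all $t\ge0$ and all $v\in\mathbb R^d$. Then: 1. if the error decays exponentially for some $p>0$, then $(A,H)$ is detectable; 2. if the time averages $\frac1t\int_0^t\tilde R_{jj}(\tau)\,d\tau$ converge as $t\to\infty$ for $j=1,\dots,k$, then there exists $p>0$ for which the error decays exponentially if and only if $(A,H)$ is detectable. -/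

import Mathlib

open Filter Set MeasureTheory Matrix
open scoped Topology

noncomputable section

namespace LinearObserver

/-- Euclidean norm of a coordinate vector. -/
def enorm2 {n : ℕ} (v : Fin n → ℝ) : ℝ := ‖WithLp.toLp 2 v‖

/-- `sup_{t ≥ 0} sup_{‖x‖ = 1} ‖M(t) x‖ < ∞`. -/
def BoundedInTime {m n : ℕ} (M : ℝ → Matrix (Fin m) (Fin n) ℝ) : Prop :=
  ∃ K : ℝ, ∀ t, 0 ≤ t → ∀ x : Fin n → ℝ, enorm2 x = 1 → enorm2 (M t *ᵥ x) ≤ K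

/-- The time average `(1/t) ∫₀ᵗ g(s) ds`. -/
def timeAverage (g : ℝ → ℝ) (t : ℝ) : ℝ := (1 / t) * ∫ s in (0 : ℝ)..t, g s

/-- Forward solution on `[0, ∞)` of `ẋ = F(t, x)`, `x(0) = x₀`, in integrated (Carathéodory) form.
The integrated form is used because the thin QR factor of `Hᵀ H Q`, and with it the gain, may jump
in time where the rank drops. -/
def IsSolution {n : ℕ} (F : ℝ → (Fin n → ℝ) → (Fin n → ℝ)) (x₀ : Fin n → ℝ)
    (x : ℝ → Fin n → ℝ) : Prop :=
  ∀ t, 0 ≤ t → IntervalIntegrable (fun s => F s (x s)) volume 0 t ∧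
    x t = x₀ + ∫ s in (0 : ℝ)..t, F s (x s)

/-- `Φ` is the solution of `Ẋ = A(t) X`, `X(0) = I`, on `[0, ∞)`. -/
def IsFlow {d : ℕ} (A Φ : ℝ → Matrix (Fin d) (Fin d) ℝ) : Prop :=
  Φ 0 = 1 ∧ ∀ t, 0 ≤ t → ∀ i j,
    HasDerivWithinAt (fun τ => Φ τ i j) ((A t * Φ t) i j) (Ici 0) t

open Classical in
/-- `λ(v) = limsup_{t → ∞} (1/t) log ‖Φ(t) v‖`, with `λ(0) = -∞`. -/
def lyapunovExponent {d : ℕ} (Φ : ℝ → Matrix (Fin d) (Fin d) ℝ) (v : Fin d → ℝ) : EReal :=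
  if v = 0 then ⊥
  else limsup (fun t : ℝ => ((1 / t * Real.log (enorm2 (Φ t *ᵥ v)) : ℝ) : EReal)) atTop

/-- `lam 0 ≥ lam 1 ≥ …` are the `d` values of the Lyapunov exponent function, counted with
multiplicity: the number of them that are at most `c` is the dimension of the member
`{v | λ(v) ≤ c}` of the filtration (this set is a linear subspace, hence equal to its span). -/
def IsLyapunovSpectrum {d : ℕ} (Φ : ℝ → Matrix (Fin d) (Fin d) ℝ) (lam : Fin d → ℝ) : Prop :=
  Antitone lam ∧ ∀ c : ℝ, (Finset.univ.filter fun i => lam i ≤ c).card =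
    Module.finrank ℝ (Submodule.span ℝ {v : Fin d → ℝ | lyapunovExponent Φ v ≤ (c : EReal)})

/-- The skew-symmetric matrix with the same entries as `M` below the diagonal. -/
def skewOfLower {k : ℕ} (M : Matrix (Fin k) (Fin k) ℝ) : Matrix (Fin k) (Fin k) ℝ :=
  Matrix.of fun i j => if j < i then M i j else if i < j then -M j i else 0

/-- Right-hand side of the continuous QR equation `Q̇ = (I - Q Qᵀ) A Q + Q S`, where `S` is
skew-symmetric and makes `Qᵀ A Q - S` upper triangular. -/
def qrField {d k : ℕ} (A : Matrix (Fin d) (Fin d) ℝ) (Q : Matrix (Fin d) (Fin k) ℝ) :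
    Matrix (Fin d) (Fin k) ℝ :=
  (1 - Q * Qᵀ) * A * Q + Q * skewOfLower (Qᵀ * A * Q)

/-- `Q` has orthonormal columns and solves the continuous QR equation on `[0, ∞)`.
For `k = d` the matrix `Q` is orthogonal and the equation reads `Q̇ = Q S`. -/
def IsContinuousQR {d k : ℕ} (A : ℝ → Matrix (Fin d) (Fin d) ℝ)
    (Q : ℝ → Matrix (Fin d) (Fin k) ℝ) : Prop :=
  ∀ t, 0 ≤ t → (Q t)ᵀ * Q t = 1 ∧ ∀ i j,
    HasDerivWithinAt (fun τ => Q τ i j) (qrField (A t) (Q t) i j) (Ici 0) t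

/-- The upper triangular coefficient matrix `B = Qᵀ A Q - S` of `Ṙ = B R`. -/
def coeffB {d k : ℕ} (A : ℝ → Matrix (Fin d) (Fin d) ℝ) (Q : ℝ → Matrix (Fin d) (Fin k) ℝ)
    (t : ℝ) : Matrix (Fin k) (Fin k) ℝ :=
  (Q t)ᵀ * A t * Q t - skewOfLower ((Q t)ᵀ * A t * Q t)

/-- Forward regularity: the time averages of all the diagonal entries of `B` converge. -/
def ForwardRegular {d : ℕ} (A QQ : ℝ → Matrix (Fin d) (Fin d) ℝ) : Prop :=
  ∀ i, ∃ l : ℝ, Tendsto (timeAverage fun s => coeffB A QQ s i i) atTop (𝓝 l)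

/-- The factor `Q̃` of the thin QR factorisation of `Y`: the columns of `Y` are orthonormalised by
the Gram-Schmidt process; a column that depends linearly on the preceding ones gives `0`. -/
def thinQ {d k : ℕ} (Y : Matrix (Fin d) (Fin k) ℝ) : Matrix (Fin d) (Fin k) ℝ :=
  Matrix.of fun i j =>
    InnerProductSpace.gramSchmidtNormed ℝ
      (fun l : Fin k => (WithLp.toLp 2 (fun m => Y m l) : EuclideanSpace ℝ (Fin d))) j i

/-- The upper triangular factor `R̃` of the thin QR factorisation `Y = Q̃ R̃`. -/
def thinR {d k : ℕ} (Y : Matrix (Fin d) (Fin k) ℝ) : Matrix (Fin k) (Fin k) ℝ :=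
  (thinQ Y)ᵀ * Y

/-- The matrix `Hᵀ H Q` at time `t`. -/
def observedBasis {d k s : ℕ} (H : ℝ → Matrix (Fin s) (Fin d) ℝ)
    (Q : ℝ → Matrix (Fin d) (Fin k) ℝ) (t : ℝ) : Matrix (Fin d) (Fin k) ℝ :=
  (H t)ᵀ * H t * Q t

/-- The time average of `R̃_jj`, where `Q̃ R̃ = Hᵀ H Q` is the thin QR factorisation. -/
def observability {d k s : ℕ} (H : ℝ → Matrix (Fin s) (Fin d) ℝ)
    (Q : ℝ → Matrix (Fin d) (Fin k) ℝ) (j : Fin k) : ℝ → ℝ :=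
  timeAverage fun τ => thinR (observedBasis H Q τ) j j

/-- `(A, H)` is detectable in the direction `Q_j`. -/
def DetectableInDirection {d k s : ℕ} (H : ℝ → Matrix (Fin s) (Fin d) ℝ)
    (Q : ℝ → Matrix (Fin d) (Fin k) ℝ) (j : Fin k) : Prop :=
  0 < limsup (observability H Q j) atTop

/-- `(A, H)` is detectable: it is detectable in every direction `Q_j` of the non-stable tangent
space, i.e. with `lim (1/t) ∫₀ᵗ B_jj ≥ 0`. -/
def Detectable {d k s : ℕ} (A : ℝ → Matrix (Fin d) (Fin d) ℝ) (H : ℝ → Matrix (Fin s) (Fin d) ℝ)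
    (Q : ℝ → Matrix (Fin d) (Fin k) ℝ) : Prop :=
  ∀ j : Fin k,
    (∃ l : ℝ, 0 ≤ l ∧ Tendsto (timeAverage fun τ => coeffB A Q τ j j) atTop (𝓝 l)) →
      DetectableInDirection H Q j

/-- The gain `L = p Q Q̃ᵀ Hᵀ`. -/
def gain {d k s : ℕ} (H : ℝ → Matrix (Fin s) (Fin d) ℝ) (Q : ℝ → Matrix (Fin d) (Fin k) ℝ)
    (p : ℝ) (t : ℝ) : Matrix (Fin d) (Fin s) ℝ :=
  p • (Q t * (thinQ (observedBasis H Q t))ᵀ * (H t)ᵀ)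

/-- The estimation error `ξ = z - x` decays exponentially, where `ż = A z`, `z(0) = v`, is the
signal with noise-free output `y = H z`, and `ẋ = A x + L (y - H x)`, `x(0) = 0`, is the observer:
`‖ξ(t)‖ ≤ C e^{-a t} ‖ξ(0)‖` with `C, a > 0` independent of `v`. -/
def ErrorDecaysExponentially {d s : ℕ} (A : ℝ → Matrix (Fin d) (Fin d) ℝ)
    (H : ℝ → Matrix (Fin s) (Fin d) ℝ) (L : ℝ → Matrix (Fin d) (Fin s) ℝ) : Prop :=
  ∃ C > 0, ∃ a > 0, ∀ (v : Fin d → ℝ) (z x : ℝ → Fin d → ℝ),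
    IsSolution (fun t w => A t *ᵥ w) v z →
    IsSolution (fun t w => A t *ᵥ w + L t *ᵥ (H t *ᵥ z t - H t *ᵥ w)) 0 x →
    ∀ t, 0 ≤ t → enorm2 (z t - x t) ≤ C * Real.exp (-a * t) * enorm2 (z 0 - x 0)

end LinearObserver

end

/-!
The coordinates `η = ℚᵀ ξ` of the error `ξ̇ = (A - L H) ξ` in the moving frame `ℚ` satisfy an upper
triangular equation whose diagonal entries are `B_jj - p R̃_jj` for `j ≤ k` and `B_jj` for `j > k`.
If `η(0) = e_j`, then `η_j` is the exponential of the integral of the `j`th diagonal entry, so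
exponential decay forces all time averages of the diagonal to be eventually smaller than a negative
constant, which gives detectability. Conversely, a bounded triangular equation whose diagonal
entries have negative mean values is exponentially stable. Detectability makes the first `k` of them
negative for large `p`. For `j > k` the mean value of `B_jj` is negative because the stable subspace
has dimension `d - k` and is transversal to the columns of `Q(0)`: it contains a vector `w` with
`ℚ(0)ᵀ w = e_j` up to the first `k` coordinates, and the `j`th coordinate of `ℚᵀ ξ(·; w)` is then
the exponential of the integral of `B_jj`.
-/

noncomputable section

namespace LinearObserver

section LocallyIntegrable

theorem locallyIntegrableOn_finsetSum {X E ι : Type*} [MeasurableSpace X] [TopologicalSpace X]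
    [NormedAddCommGroup E] {μ : Measure X} {s : Set X} (S : Finset ι) {f : ι → X → E}
    (hf : ∀ i ∈ S, LocallyIntegrableOn (f i) s μ) :
    LocallyIntegrableOn (fun x => ∑ i ∈ S, f i x) s μ := by
  simpa only [← Finset.sum_apply] using Finset.sum_induction f (LocallyIntegrableOn · s μ)
    (fun _ _ => LocallyIntegrableOn.add) locallyIntegrableOn_zero hf

theorem locallyIntegrableOn_Ici_iff {E : Type*} [NormedAddCommGroup E] {f : ℝ → E} {a : ℝ} :
    LocallyIntegrableOn f (Ici a) ↔ ∀ b, a ≤ b → IntervalIntegrable f volume a b := by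
  refine ⟨fun h b hab => ?_, fun h x hx => ⟨Icc a (x + 1), ?_, ?_⟩⟩
  · rw [intervalIntegrable_iff_integrableOn_Icc_of_le hab]
    exact h.integrableOn_compact_subset Icc_subset_Ici_self isCompact_Icc
  · rw [← Ici_inter_Iic]
    exact inter_mem_nhdsWithin _ (Iic_mem_nhds (lt_add_one x))
  · rw [← intervalIntegrable_iff_integrableOn_Icc_of_le (by linarith [mem_Ici.1 hx])]
    exact h _ (by linarith [mem_Ici.1 hx])

end LocallyIntegrable

section AbsolutelyContinuous

variable {X Y : Type*} [PseudoMetricSpace X] [PseudoMetricSpace Y] {f g : ℝ → X} {a b : ℝ}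

theorem absolutelyContinuousOnInterval_congr (hf : AbsolutelyContinuousOnInterval f a b)
    (hfg : EqOn f g (uIcc a b)) : AbsolutelyContinuousOnInterval g a b := by
  rw [absolutelyContinuousOnInterval_iff] at hf ⊢
  intro ε hε
  obtain ⟨δ, hδ, hfδ⟩ := hf ε hε
  refine ⟨δ, hδ, fun E hE hlen => ?_⟩
  convert hfδ E hE hlen using 4 with i hi
  · exact (hfg (hE.1 i hi).1).symm
  · exact (hfg (hE.1 i hi).2).symm

theorem absolutelyContinuousOnInterval_comp_of_lipschitzOnWith {φ : X → Y} {K : NNReal} {s : Set X}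
    (hφ : LipschitzOnWith K φ s) (hf : AbsolutelyContinuousOnInterval f a b)
    (hfs : MapsTo f (uIcc a b) s) : AbsolutelyContinuousOnInterval (φ ∘ f) a b := by
  rw [absolutelyContinuousOnInterval_iff] at hf ⊢
  intro ε hε
  obtain ⟨δ, hδ, hfδ⟩ := hf (ε / (K + 1)) (by positivity)
  refine ⟨δ, hδ, fun E hE hlen => ?_⟩
  have hlt := (lt_div_iff₀' (by positivity)).1 (hfδ E hE hlen)
  refine lt_of_le_of_lt ?_ hlt
  rw [Finset.mul_sum]
  refine Finset.sum_le_sum fun i hi => ?_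
  calc dist (φ (f (E.2 i).1)) (φ (f (E.2 i).2))
      ≤ K * dist (f (E.2 i).1) (f (E.2 i).2) :=
        hφ.dist_le_mul _ (hfs (hE.1 i hi).1) _ (hfs (hE.1 i hi).2)
    _ ≤ (K + 1) * dist (f (E.2 i).1) (f (E.2 i).2) := by gcongr; linarith

theorem absolutelyContinuousOnInterval_exp {f : ℝ → ℝ}
    (hf : AbsolutelyContinuousOnInterval f a b) :
    AbsolutelyContinuousOnInterval (fun t => Real.exp (f t)) a b := by
  obtain ⟨M, hM⟩ := hf.exists_bound
  obtain ⟨K, hK⟩ : ∃ K, LipschitzOnWith K Real.exp (Icc (-M) M) :=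
    (Real.contDiff_exp (n := 1)).contDiffOn.exists_lipschitzOnWith one_ne_zero
      (convex_Icc (-M) M) isCompact_Icc
  exact absolutelyContinuousOnInterval_comp_of_lipschitzOnWith (φ := Real.exp) (f := f) hK hf
    fun t ht => abs_le.1 (hM t ht)

end AbsolutelyContinuous

/-- `F` is an indefinite integral on `[0, ∞)` of the locally integrable function `f`; equivalently,
`F` is locally absolutely continuous there with derivative `f` almost everywhere. -/
structure IsAntideriv (F f : ℝ → ℝ) : Prop where
  locallyIntegrableOn : LocallyIntegrableOn f (Ici 0)
  eq_add_integral : ∀ t, 0 ≤ t → F t = F 0 + ∫ s in (0 : ℝ)..t, f s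

theorem intervalIntegral_congr_of_eqOn_Ici {f g : ℝ → ℝ} (hfg : EqOn f g (Ici 0)) {t : ℝ}
    (ht : 0 ≤ t) : ∫ s in (0 : ℝ)..t, f s = ∫ s in (0 : ℝ)..t, g s :=
  intervalIntegral.integral_congr fun s hs => hfg (by rw [uIcc_of_le ht] at hs; exact hs.1)

namespace IsAntideriv

variable {F G f g : ℝ → ℝ}

theorem intervalIntegrable (hF : IsAntideriv F f) {t : ℝ} (ht : 0 ≤ t) :
    IntervalIntegrable f volume 0 t :=
  locallyIntegrableOn_Ici_iff.1 hF.locallyIntegrableOn t ht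

theorem absolutelyContinuousOnInterval (hF : IsAntideriv F f) {T : ℝ} (hT : 0 ≤ T) :
    AbsolutelyContinuousOnInterval F 0 T := by
  have hint := (hF.intervalIntegrable hT).absolutelyContinuousOnInterval_intervalIntegral
    left_mem_uIcc
  have hconst : AbsolutelyContinuousOnInterval (fun _ => F 0) 0 T :=
    contDiffOn_const.absolutelyContinuousOnInterval
  refine absolutelyContinuousOnInterval_congr (hconst.add hint) fun t ht => ?_
  rw [uIcc_of_le hT] at ht
  exact (hF.eq_add_integral t ht.1).symm

theorem continuousOn (hF : IsAntideriv F f) : ContinuousOn F (Ici 0) := by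
  intro t ht
  have hcont := (hF.absolutelyContinuousOnInterval (add_nonneg ht zero_le_one)).continuousOn
  rw [uIcc_of_le (add_nonneg ht zero_le_one), ← Ici_inter_Iic] at hcont
  exact (hcont t ⟨ht, (lt_add_one t).le⟩).mono_of_mem_nhdsWithin
    (inter_mem_nhdsWithin _ (Iic_mem_nhds (lt_add_one t)))

theorem ae_hasDerivAt (hF : IsAntideriv F f) : ∀ᵐ t, 0 < t → HasDerivAt F (f t) t := by
  have hint : ∀ᵐ t, ∀ n : ℕ, t ∈ uIcc (0 : ℝ) n →
      HasDerivAt (fun y => ∫ s in (0 : ℝ)..y, f s) (f t) t := by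
    refine ae_all_iff.2 fun n => ?_
    filter_upwards [(hF.intervalIntegrable n.cast_nonneg).ae_hasDerivAt_integral] with t h ht
    exact h ht 0 left_mem_uIcc
  filter_upwards [hint] with t h ht
  obtain ⟨n, hn⟩ := exists_nat_ge t
  have hderiv := (h n (by rw [uIcc_of_le n.cast_nonneg]; exact ⟨ht.le, hn⟩)).const_add (F 0)
  refine hderiv.congr_of_eventuallyEq ?_
  filter_upwards [lt_mem_nhds ht] with y hy
  exact hF.eq_add_integral y hy.le

end IsAntideriv

theorem isAntideriv_iff {F f : ℝ → ℝ} : IsAntideriv F f ↔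
    (∀ T, 0 ≤ T → AbsolutelyContinuousOnInterval F 0 T) ∧
      ∀ᵐ t, 0 < t → HasDerivAt F (f t) t := by
  refine ⟨fun hF => ⟨fun T => hF.absolutelyContinuousOnInterval, hF.ae_hasDerivAt⟩, ?_⟩
  rintro ⟨hac, hderiv⟩
  have hae : ∀ t, 0 ≤ t → deriv F =ᵐ[volume.restrict (uIoc 0 t)] f := fun t ht => by
    rw [EventuallyEq, ae_restrict_iff' measurableSet_uIoc, uIoc_of_le ht]
    filter_upwards [hderiv] with x hx hxt
    exact (hx hxt.1).deriv
  refine ⟨locallyIntegrableOn_Ici_iff.2 fun t ht =>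
    (hac t ht).intervalIntegrable_deriv.congr_ae (hae t ht), fun t ht => ?_⟩
  rw [← intervalIntegral.integral_congr_ae_restrict (hae t ht), (hac t ht).integral_deriv_eq_sub]
  ring

theorem isAntideriv_const_add_integral {f : ℝ → ℝ} (hf : LocallyIntegrableOn f (Ici 0)) (c : ℝ) :
    IsAntideriv (fun t => c + ∫ s in (0 : ℝ)..t, f s) f :=
  ⟨hf, fun t _ => by simp⟩

theorem isAntideriv_of_hasDerivWithinAt {F f : ℝ → ℝ} (hf : LocallyIntegrableOn f (Ici 0))
    (hF : ∀ t, 0 ≤ t → HasDerivWithinAt F (f t) (Ici 0) t) : IsAntideriv F f := by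
  refine ⟨hf, fun t ht => ?_⟩
  rw [intervalIntegral.integral_eq_sub_of_hasDerivAt_of_le ht
    (fun s hs => (hF s hs.1).continuousWithinAt.mono Icc_subset_Ici_self)
    (fun s hs => (hF s hs.1.le).hasDerivAt (Ici_mem_nhds hs.1))
    (locallyIntegrableOn_Ici_iff.1 hf t ht)]
  ring

namespace IsAntideriv

variable {F G f g : ℝ → ℝ}

theorem congr (hF : IsAntideriv F f) (hFG : EqOn F G (Ici 0)) (hfg : EqOn f g (Ici 0)) :
    IsAntideriv G g where
  locallyIntegrableOn := hF.locallyIntegrableOn.congr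
    (ae_restrict_of_forall_mem measurableSet_Ici hfg)
  eq_add_integral t ht := by
    rw [← hFG ht, ← hFG self_mem_Ici, ← intervalIntegral_congr_of_eqOn_Ici hfg ht]
    exact hF.eq_add_integral t ht

theorem sub (hF : IsAntideriv F f) (hG : IsAntideriv G g) :
    IsAntideriv (fun t => F t - G t) (fun t => f t - g t) where
  locallyIntegrableOn := hF.locallyIntegrableOn.sub hG.locallyIntegrableOn
  eq_add_integral t ht := by
    rw [intervalIntegral.integral_sub (hF.intervalIntegrable ht) (hG.intervalIntegrable ht),
      hF.eq_add_integral t ht, hG.eq_add_integral t ht]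
    ring

theorem sum {ι : Type*} (S : Finset ι) {F f : ι → ℝ → ℝ}
    (hF : ∀ i ∈ S, IsAntideriv (F i) (f i)) :
    IsAntideriv (fun t => ∑ i ∈ S, F i t) (fun t => ∑ i ∈ S, f i t) where
  locallyIntegrableOn := locallyIntegrableOn_finsetSum S fun i hi => (hF i hi).locallyIntegrableOn
  eq_add_integral t ht := by
    rw [intervalIntegral.integral_finsetSum fun i hi => (hF i hi).intervalIntegrable ht,
      ← Finset.sum_add_distrib]
    exact Finset.sum_congr rfl fun i hi => (hF i hi).eq_add_integral t ht

theorem mul (hF : IsAntideriv F f) (hG : IsAntideriv G g) :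
    IsAntideriv (fun t => F t * G t) (fun t => f t * G t + F t * g t) := by
  refine isAntideriv_iff.2 ⟨fun T hT =>
    (hF.absolutelyContinuousOnInterval hT).mul (hG.absolutelyContinuousOnInterval hT), ?_⟩
  filter_upwards [hF.ae_hasDerivAt, hG.ae_hasDerivAt] with t hFt hGt ht
  exact (hFt ht).mul (hGt ht)

theorem exp (hF : IsAntideriv F f) :
    IsAntideriv (fun t => Real.exp (F t)) (fun t => Real.exp (F t) * f t) := by
  refine isAntideriv_iff.2 ⟨fun T hT =>
    absolutelyContinuousOnInterval_exp (hF.absolutelyContinuousOnInterval hT), ?_⟩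
  filter_upwards [hF.ae_hasDerivAt] with t hFt ht
  exact (hFt ht).exp

end IsAntideriv

/-- The solution `e^{∫c} (a + ∫ g e^{-∫c})` of the scalar equation `ẏ = c y + g`, `y(0) = a`. -/
def variationOfConstants (c g : ℝ → ℝ) (a t : ℝ) : ℝ :=
  Real.exp (∫ s in (0 : ℝ)..t, c s) *
    (a + ∫ s in (0 : ℝ)..t, g s * Real.exp (-∫ r in (0 : ℝ)..s, c r))

section VariationOfConstants

variable {c g : ℝ → ℝ}

theorem variationOfConstants_zero (a : ℝ) : variationOfConstants c g a 0 = a := by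
  simp [variationOfConstants]

theorem isAntideriv_exp_neg_integral (hc : LocallyIntegrableOn c (Ici 0)) :
    IsAntideriv (fun t => Real.exp (-∫ s in (0 : ℝ)..t, c s))
      (fun t => Real.exp (-∫ s in (0 : ℝ)..t, c s) * -c t) :=
  IsAntideriv.exp ⟨hc.neg, fun t _ => by simp⟩

theorem isAntideriv_variationOfConstants (hc : LocallyIntegrableOn c (Ici 0))
    (hg : LocallyIntegrableOn g (Ici 0)) (a : ℝ) :
    IsAntideriv (variationOfConstants c g a) fun t => c t * variationOfConstants c g a t + g t := by
  have hexp := (isAntideriv_const_add_integral hc 0).exp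
  simp only [zero_add] at hexp
  have hint := isAntideriv_const_add_integral
    (hg.mul_continuousOn (isAntideriv_exp_neg_integral hc).continuousOn isLocallyClosed_Ici) a
  refine (hexp.mul hint).congr (fun _ _ => rfl) fun t _ => ?_
  simp only [variationOfConstants, Real.exp_neg]
  field_simp

theorem IsAntideriv.eq_variationOfConstants {f : ℝ → ℝ} (hc : LocallyIntegrableOn c (Ici 0))
    (hf : IsAntideriv f fun t => c t * f t + g t) {t : ℝ} (ht : 0 ≤ t) :
    f t = variationOfConstants c g (f 0) t := by
  have hprod : IsAntideriv (fun t => f t * Real.exp (-∫ s in (0 : ℝ)..t, c s))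
      (fun t => g t * Real.exp (-∫ s in (0 : ℝ)..t, c s)) :=
    (hf.mul (isAntideriv_exp_neg_integral hc)).congr (fun _ _ => rfl) fun t _ => by ring
  have heq := hprod.eq_add_integral t ht
  simp only [intervalIntegral.integral_same, neg_zero, Real.exp_zero, mul_one] at heq
  rw [variationOfConstants, ← heq, Real.exp_neg]
  field_simp

theorem IsAntideriv.eq_mul_exp {f : ℝ → ℝ} (hc : LocallyIntegrableOn c (Ici 0))
    (hf : IsAntideriv f fun t => c t * f t) {t : ℝ} (ht : 0 ≤ t) :
    f t = f 0 * Real.exp (∫ s in (0 : ℝ)..t, c s) := by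
  have hf' : IsAntideriv f fun t => c t * f t + 0 := by simpa only [add_zero] using hf
  simpa [variationOfConstants, mul_comm] using hf'.eq_variationOfConstants hc ht

end VariationOfConstants

/-- The entries of the matrix function `M` are measurable and essentially bounded on `[0, ∞)`. -/
def EssBounded {m n : Type*} (M : ℝ → Matrix m n ℝ) : Prop :=
  ∀ i j, MemLp (fun t => M t i j) ⊤ (volume.restrict (Ici 0))

namespace EssBounded

variable {m n r : Type*} {M : ℝ → Matrix m n ℝ}

theorem locallyIntegrableOn (hM : EssBounded M) (i : m) (j : n) :
    LocallyIntegrableOn (fun t => M t i j) (Ici 0) :=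
  locallyIntegrableOn_of_locallyIntegrable_restrict ((hM i j).locallyIntegrable le_top)

theorem exists_ae_abs_le [Finite m] [Finite n] (hM : EssBounded M) :
    ∃ K, 0 ≤ K ∧ ∀ᵐ t ∂volume.restrict (Ici 0), ∀ i j, |M t i j| ≤ K := by
  have := Fintype.ofFinite (m × n)
  let K := fun x : m × n =>
    lpNorm (fun t => M t x.1 x.2) ⊤ (volume.restrict (Ici (0 : ℝ)))
  refine ⟨∑ x, K x, Finset.sum_nonneg fun x _ => lpNorm_nonneg, ?_⟩
  filter_upwards [ae_all_iff.2 fun x : m × n => ae_le_lpNorm_exponent_top (hM x.1 x.2)]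
    with t ht i j
  exact (ht (i, j)).trans
    (Finset.single_le_sum (f := K) (fun x _ => lpNorm_nonneg) (Finset.mem_univ (i, j)))

theorem congr {N : ℝ → Matrix m n ℝ} (hM : EssBounded M) (h : EqOn M N (Ici 0)) : EssBounded N :=
  fun i j => (hM i j).ae_eq <| ae_restrict_of_forall_mem measurableSet_Ici fun t ht => by
    simp only [h ht]

theorem transpose (hM : EssBounded M) : EssBounded fun t => (M t)ᵀ := fun i j => hM j i

theorem submatrix {m' n' : Type*} (hM : EssBounded M) (f : m' → m) (g : n' → n) :
    EssBounded fun t => (M t).submatrix f g := fun i j => hM (f i) (g j)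

theorem sub {N : ℝ → Matrix m n ℝ} (hM : EssBounded M) (hN : EssBounded N) :
    EssBounded fun t => M t - N t := fun i j => (hM i j).sub (hN i j)

theorem const_smul (hM : EssBounded M) (c : ℝ) : EssBounded fun t => c • M t :=
  fun i j => (hM i j).const_mul c

theorem mul [Fintype n] {N : ℝ → Matrix n r ℝ} (hM : EssBounded M) (hN : EssBounded N) :
    EssBounded fun t => M t * N t := fun i j => by
  simp only [Matrix.mul_apply]
  exact memLp_finsetSum _ fun l _ => (hN l j).mul (hM i l)

end EssBounded

/-- `η̇ = C(t) η` on `[0, ∞)`, in integrated form and coordinate by coordinate. -/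
def SolvesLinear {ι : Type*} [Fintype ι] (C : ℝ → Matrix ι ι ℝ) (η : ℝ → ι → ℝ) : Prop :=
  ∀ i, IsAntideriv (fun t => η t i) fun t => (C t *ᵥ η t) i

section Triangular

variable {ι : Type*} [Fintype ι] [LinearOrder ι] {C : ℝ → Matrix ι ι ℝ} {η : ℝ → ι → ℝ}

theorem mulVec_apply_of_isUpperTriangular {M : Matrix ι ι ℝ} (hM : M.IsUpperTriangular)
    (w : ι → ℝ) (i : ι) : (M *ᵥ w) i = M i i * w i + ∑ l with i < l, M i l * w l := by
  have hzero : ∀ l ∈ Finset.univ.erase i, l ∉ Finset.univ.filter (i < ·) → M i l * w l = 0 := by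
    intro l hl hil
    have hlt : l < i := lt_of_le_of_ne (by simpa using hil) (Finset.ne_of_mem_erase hl)
    rw [hM hlt, zero_mul]
  have hsub : Finset.univ.filter (i < ·) ⊆ Finset.univ.erase i := fun l hl => by
    simpa using (Finset.mem_filter.1 hl).2.ne'
  rw [mulVec, dotProduct, ← Finset.add_sum_erase _ _ (Finset.mem_univ i),
    Finset.sum_subset hsub hzero]

theorem SolvesLinear.isAntideriv_of_isUpperTriangular (hη : SolvesLinear C η)
    (hC : ∀ t, 0 ≤ t → (C t).IsUpperTriangular) (i : ι) :
    IsAntideriv (fun t => η t i)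
      fun t => C t i i * η t i + ∑ l with i < l, C t i l * η t l :=
  (hη i).congr (fun _ _ => rfl) fun t ht => mulVec_apply_of_isUpperTriangular (hC t ht) _ i

/-- The solution of an upper triangular linear system, built from the last coordinate upwards. -/
def triangularSolution (C : ℝ → Matrix ι ι ℝ) (v : ι → ℝ) (i : ι) : ℝ → ℝ :=
  variationOfConstants (fun t => C t i i)
    (fun t => ∑ l : {l // i < l}, C t i l * triangularSolution C v l t) (v i)
termination_by wellFounded_gt.wrap i
decreasing_by exact l.2

theorem triangularSolution_eq (C : ℝ → Matrix ι ι ℝ) (v : ι → ℝ) (i : ι) :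
    triangularSolution C v i = variationOfConstants (fun t => C t i i)
      (fun t => ∑ l : {l // i < l}, C t i l * triangularSolution C v l t) (v i) := by
  rw [triangularSolution]

theorem exists_solvesLinear_of_isUpperTriangular
    (hC : ∀ t, 0 ≤ t → (C t).IsUpperTriangular)
    (hint : ∀ i l, LocallyIntegrableOn (fun t => C t i l) (Ici 0)) (v : ι → ℝ) :
    ∃ η : ℝ → ι → ℝ, η 0 = v ∧ SolvesLinear C η := by
  refine ⟨fun t i => triangularSolution C v i t, funext fun i =>
    (congrFun (triangularSolution_eq C v i) 0).trans (variationOfConstants_zero _), fun i => ?_⟩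
  induction i using WellFoundedGT.induction with
  | ind i ih =>
    have hforcing : LocallyIntegrableOn
        (fun t => ∑ l : {l // i < l}, C t i l * triangularSolution C v l t) (Ici 0) :=
      locallyIntegrableOn_finsetSum _ fun l _ =>
        (hint i l).mul_continuousOn (ih l l.2).continuousOn isLocallyClosed_Ici
    refine (isAntideriv_variationOfConstants (hint i i) hforcing (v i)).congr
      (fun t _ => (congrFun (triangularSolution_eq C v i) t).symm) fun t ht => ?_
    simp only [mulVec_apply_of_isUpperTriangular (hC t ht)]
    congr 1
    · rw [triangularSolution_eq]
    · exact (Finset.sum_subtype (Finset.univ.filter (i < ·)) (by simp)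
        fun l => C t i l * triangularSolution C v l t).symm

theorem SolvesLinear.eq_mul_exp_of_forall_eq_zero (hη : SolvesLinear C η)
    (hC : ∀ t, 0 ≤ t → (C t).IsUpperTriangular)
    (hint : ∀ i l, LocallyIntegrableOn (fun t => C t i l) (Ici 0)) {i : ι}
    (h : ∀ l, i < l → ∀ t, 0 ≤ t → η t l = 0) {t : ℝ} (ht : 0 ≤ t) :
    η t i = η 0 i * Real.exp (∫ s in (0 : ℝ)..t, C s i i) := by
  refine IsAntideriv.eq_mul_exp (f := fun t => η t i) (hint i i) ?_ ht
  refine (hη.isAntideriv_of_isUpperTriangular hC i).congr (fun _ _ => rfl) fun s hs => ?_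
  simp only [add_eq_left]
  exact Finset.sum_eq_zero fun l hl => by rw [h l (Finset.mem_filter.1 hl).2 s hs, mul_zero]

theorem SolvesLinear.eq_zero_of_isUpperSet (hη : SolvesLinear C η)
    (hC : ∀ t, 0 ≤ t → (C t).IsUpperTriangular)
    (hint : ∀ i l, LocallyIntegrableOn (fun t => C t i l) (Ici 0)) {U : Set ι} (hU : IsUpperSet U)
    {T : ℝ} (hT : 0 ≤ T) (h : ∀ i ∈ U, η T i = 0) :
    ∀ i ∈ U, ∀ t, 0 ≤ t → η t i = 0 := by
  intro i
  induction i using WellFoundedGT.induction with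
  | ind i ih =>
    intro hi t ht
    have hexp := fun {s : ℝ} (hs : 0 ≤ s) =>
      hη.eq_mul_exp_of_forall_eq_zero hC hint (fun l hl => ih l hl (hU hl.le hi)) hs
    have h0 : η 0 i = 0 := by
      have hTi := hexp hT
      rw [h i hi, eq_comm, mul_eq_zero] at hTi
      exact hTi.resolve_right (Real.exp_ne_zero _)
    rw [hexp ht, h0, zero_mul]

theorem SolvesLinear.eq_mul_exp (hη : SolvesLinear C η)
    (hC : ∀ t, 0 ≤ t → (C t).IsUpperTriangular)
    (hint : ∀ i l, LocallyIntegrableOn (fun t => C t i l) (Ici 0)) {i : ι}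
    (h : ∀ l, i < l → η 0 l = 0) {t : ℝ} (ht : 0 ≤ t) :
    η t i = η 0 i * Real.exp (∫ s in (0 : ℝ)..t, C s i i) :=
  hη.eq_mul_exp_of_forall_eq_zero hC hint
    (hη.eq_zero_of_isUpperSet hC hint (isUpperSet_Ioi i) le_rfl h) ht

end Triangular

section Decay

theorem exists_abs_integral_sub_le {c : ℝ → ℝ} (hc : LocallyIntegrableOn c (Ici 0)) {m : ℝ}
    (hm : Tendsto (timeAverage c) atTop (𝓝 m)) {ε : ℝ} (hε : 0 < ε) :
    ∃ D, ∀ t, 0 ≤ t → |(∫ s in (0 : ℝ)..t, c s) - m * t| ≤ ε * t + D := by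
  have hcont : ContinuousOn (fun t => (∫ s in (0 : ℝ)..t, c s) - m * t) (Ici 0) := by
    have := (isAntideriv_const_add_integral hc 0).continuousOn
    simp only [zero_add] at this
    exact this.sub (by fun_prop)
  obtain ⟨T, hT⟩ := eventually_atTop.1
    ((Metric.tendsto_nhds.1 hm ε hε).and (eventually_gt_atTop 0))
  obtain ⟨D, hD⟩ := isCompact_Icc.exists_bound_of_continuousOn
    (hcont.mono (Icc_subset_Ici_self (a := T) (b := 0)))
  refine ⟨max D 0, fun t ht => ?_⟩
  rcases le_total t T with htT | hTt
  · exact (hD t ⟨ht, htT⟩).trans (le_add_of_nonneg_of_le (by positivity) (le_max_left D 0))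
  · obtain ⟨hdist, ht0⟩ := hT t hTt
    have heq : (∫ s in (0 : ℝ)..t, c s) - m * t = (timeAverage c t - m) * t := by
      rw [timeAverage]
      field_simp
    rw [heq, abs_mul, abs_of_pos ht0]
    rw [Real.dist_eq] at hdist
    exact le_add_of_le_of_nonneg (by gcongr) (le_max_right D 0)

variable {c g : ℝ → ℝ} {m a b ε D : ℝ}

theorem abs_mul_exp_neg_integral_le {G s t : ℝ} (hG : 0 ≤ G) (hε : 0 < ε)
    (hba : b + 3 * ε ≤ a) (hbm : b + 3 * ε ≤ -m)
    (hc : ∀ t, 0 ≤ t → |(∫ s in (0 : ℝ)..t, c s) - m * t| ≤ ε * t + D)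
    (hs : 0 ≤ s) (hst : s ≤ t) (hg : |g s| ≤ G * Real.exp (-a * s)) :
    |g s * Real.exp (-∫ r in (0 : ℝ)..s, c r)| ≤ G * Real.exp ((-m - b - 2 * ε) * t + D) := by
  rw [abs_mul, Real.abs_exp]
  calc |g s| * Real.exp (-∫ r in (0 : ℝ)..s, c r)
      ≤ (G * Real.exp (-a * s)) * Real.exp (-m * s + (ε * s + D)) := by
        gcongr
        linarith [(abs_le.1 (hc s hs)).1]
    _ = G * Real.exp ((-a - m + ε) * s + D) := by
        rw [mul_assoc, ← Real.exp_add]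
        ring_nf
    _ ≤ G * Real.exp ((-m - b - 2 * ε) * t + D) := by
        have hs' : (-a - m + ε) * s ≤ (-m - b - 2 * ε) * s := by gcongr; linarith
        have hst' : (-m - b - 2 * ε) * s ≤ (-m - b - 2 * ε) * t := by gcongr; linarith
        exact mul_le_mul_of_nonneg_left (Real.exp_le_exp.2 (by linarith)) hG

theorem abs_variationOfConstants_le {G x t : ℝ} (hG : 0 ≤ G) (hε : 0 < ε)
    (hba : b + 3 * ε ≤ a) (hbm : b + 3 * ε ≤ -m)
    (hc : ∀ t, 0 ≤ t → |(∫ s in (0 : ℝ)..t, c s) - m * t| ≤ ε * t + D)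
    (hg : ∀ᵐ s ∂volume.restrict (Ici 0), |g s| ≤ G * Real.exp (-a * s)) (ht : 0 ≤ t) :
    |variationOfConstants c g x t| ≤
      (Real.exp D * |x| + Real.exp (2 * D) / ε * G) * Real.exp (-b * t) := by
  have hexp : Real.exp (∫ s in (0 : ℝ)..t, c s) ≤ Real.exp ((m + ε) * t + D) := by
    gcongr
    linarith [(abs_le.1 (hc t ht)).2]
  have hint : |∫ s in (0 : ℝ)..t, g s * Real.exp (-∫ r in (0 : ℝ)..s, c r)| ≤
      G * Real.exp ((-m - b - 2 * ε) * t + D) * t := by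
    rw [← Real.norm_eq_abs]
    refine (intervalIntegral.norm_integral_le_of_norm_le_const_ae ?_).trans_eq
      (by rw [sub_zero, abs_of_nonneg ht])
    filter_upwards [(ae_restrict_iff' measurableSet_Ici).1 hg] with s hs hst
    rw [uIoc_of_le ht] at hst
    exact abs_mul_exp_neg_integral_le hG hε hba hbm hc hst.1.le hst.2 (hs hst.1.le)
  have hte : t ≤ Real.exp (ε * t) / ε := by
    rw [le_div_iff₀ hε]
    linarith [Real.add_one_le_exp (ε * t)]
  rw [variationOfConstants, abs_mul, Real.abs_exp]
  calc Real.exp (∫ s in (0 : ℝ)..t, c s) *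
        |x + ∫ s in (0 : ℝ)..t, g s * Real.exp (-∫ r in (0 : ℝ)..s, c r)|
      ≤ Real.exp ((m + ε) * t + D) *
        (|x| + G * Real.exp ((-m - b - 2 * ε) * t + D) * (Real.exp (ε * t) / ε)) := by
        gcongr
        exact (abs_add_le _ _).trans (by gcongr; exact hint.trans (by gcongr))
    _ = |x| * Real.exp ((m + ε) * t + D) + G / ε * Real.exp (-b * t + 2 * D) := by
        rw [show -b * t + 2 * D =
          ((m + ε) * t + D) + (((-m - b - 2 * ε) * t + D) + ε * t) by ring]
        simp only [Real.exp_add]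
        ring
    _ ≤ |x| * Real.exp (-b * t + D) + G / ε * Real.exp (-b * t + 2 * D) := by
        gcongr
        linarith
    _ = _ := by
        simp only [Real.exp_add]
        ring

theorem exists_abs_variationOfConstants_le (hc : LocallyIntegrableOn c (Ici 0))
    (hm : Tendsto (timeAverage c) atTop (𝓝 m)) (hba : b < a) (hbm : b < -m) :
    ∃ K, 0 ≤ K ∧ ∀ (g : ℝ → ℝ) (G x : ℝ), 0 ≤ G →
      (∀ᵐ s ∂volume.restrict (Ici 0), |g s| ≤ G * Real.exp (-a * s)) →
      ∀ t, 0 ≤ t → |variationOfConstants c g x t| ≤ K * (|x| + G) * Real.exp (-b * t) := by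
  obtain ⟨ε, hε, hba', hbm'⟩ : ∃ ε, 0 < ε ∧ b + 3 * ε ≤ a ∧ b + 3 * ε ≤ -m := by
    refine ⟨(min a (-m) - b) / 3, ?_, ?_, ?_⟩
    · linarith [lt_min hba hbm]
    · linarith [min_le_left a (-m)]
    · linarith [min_le_right a (-m)]
  obtain ⟨D, hD⟩ := exists_abs_integral_sub_le hc hm hε
  refine ⟨Real.exp D + Real.exp (2 * D) / ε, by positivity, fun g G x hG hg t ht =>
    (abs_variationOfConstants_le hG hε hba' hbm' hD hg ht).trans ?_⟩
  gcongr ?_ * _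
  have h1 : 0 ≤ Real.exp (2 * D) / ε * |x| := by positivity
  have h2 : 0 ≤ Real.exp D * G := by positivity
  linarith

variable {ι : Type*} [Fintype ι] [LinearOrder ι] {C : ℝ → Matrix ι ι ℝ}

theorem abs_sum_mul_le {κ : Type*} [Fintype κ] {x y K : κ → ℝ} {M B : ℝ}
    (hx : ∀ l, |x l| ≤ M) (hy : ∀ l, |y l| ≤ K l * B) (hM : 0 ≤ M) :
    |∑ l, x l * y l| ≤ M * (∑ l, K l) * B := by
  calc |∑ l, x l * y l| ≤ ∑ l, |x l| * |y l| := by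
        simpa only [abs_mul] using Finset.abs_sum_le_sum_abs (fun l => x l * y l) Finset.univ
    _ ≤ ∑ l, M * (K l * B) := by
        gcongr with l
        · exact hx l
        · exact hy l
    _ = M * (∑ l, K l) * B := by rw [← Finset.mul_sum, ← Finset.sum_mul, mul_assoc]

-- A coordinate inherits every rate below that of its forcing, so the induction has to carry all
-- small rates instead of a single one.
theorem eventually_exists_abs_apply_le (hC : ∀ t, 0 ≤ t → (C t).IsUpperTriangular)
    (hbdd : EssBounded C)
    (hdiag : ∀ i, ∃ m < 0, Tendsto (timeAverage fun t => C t i i) atTop (𝓝 m)) (i : ι) :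
    ∀ᶠ a in 𝓝[>] (0 : ℝ), ∃ K, 0 ≤ K ∧ ∀ η, SolvesLinear C η →
      ∀ t, 0 ≤ t → |η t i| ≤ K * ‖η 0‖ * Real.exp (-a * t) := by
  induction i using WellFoundedGT.induction with
  | ind i ih =>
    obtain ⟨m, hm, hlim⟩ := hdiag i
    obtain ⟨M, hM0, hM⟩ := hbdd.exists_ae_abs_le
    have hrates : ∀ᶠ a in 𝓝[>] (0 : ℝ), ∀ l : {l // i < l}, ∃ K, 0 ≤ K ∧ ∀ η, SolvesLinear C η →
        ∀ t, 0 ≤ t → |η t l| ≤ K * ‖η 0‖ * Real.exp (-a * t) :=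
      eventually_all.2 fun l => ih l l.2
    obtain ⟨a, ha, ha0⟩ := (hrates.and self_mem_nhdsWithin).exists
    choose K hK0 hK using ha
    filter_upwards [Ioo_mem_nhdsGT (lt_min ha0 (neg_pos.2 hm))] with b hb
    have hb' := lt_min_iff.1 hb.2
    obtain ⟨K', hK'0, hK'⟩ :=
      exists_abs_variationOfConstants_le (hbdd.locallyIntegrableOn i i) hlim hb'.1 hb'.2
    have hsum0 : 0 ≤ ∑ l, K l := Finset.sum_nonneg fun l _ => hK0 l
    refine ⟨K' * (1 + M * ∑ l, K l), by positivity, fun η hη t ht => ?_⟩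
    have hforcing : ∀ᵐ s ∂volume.restrict (Ici 0), |∑ l with i < l, C s i l * η s l| ≤
        M * (∑ l, K l) * ‖η 0‖ * Real.exp (-a * s) := by
      filter_upwards [hM, ae_restrict_mem measurableSet_Ici] with s hs hs0
      rw [Finset.sum_subtype (p := (i < ·)) _ (by simp)]
      exact (abs_sum_mul_le (fun l : {l // i < l} => hs i l)
        (fun l => (hK l η hη s hs0).trans_eq (mul_assoc _ _ _)) hM0).trans_eq
          (mul_assoc _ _ _).symm
    rw [(hη.isAntideriv_of_isUpperTriangular hC i).eq_variationOfConstants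
      (f := fun t => η t i) (hbdd.locallyIntegrableOn i i) ht]
    refine (hK' _ _ _ (by positivity) hforcing t ht).trans ?_
    have h0 : |η 0 i| ≤ ‖η 0‖ := norm_le_pi_norm (η 0) i
    calc K' * (|η 0 i| + M * (∑ l, K l) * ‖η 0‖) * Real.exp (-b * t)
        ≤ K' * (‖η 0‖ + M * (∑ l, K l) * ‖η 0‖) * Real.exp (-b * t) := by gcongr
      _ = K' * (1 + M * ∑ l, K l) * ‖η 0‖ * Real.exp (-b * t) := by ring

theorem exists_norm_le_mul_exp_neg (hC : ∀ t, 0 ≤ t → (C t).IsUpperTriangular)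
    (hbdd : EssBounded C)
    (hdiag : ∀ i, ∃ m < 0, Tendsto (timeAverage fun t => C t i i) atTop (𝓝 m)) :
    ∃ K, 0 ≤ K ∧ ∃ a, 0 < a ∧ ∀ η, SolvesLinear C η →
      ∀ t, 0 ≤ t → ‖η t‖ ≤ K * ‖η 0‖ * Real.exp (-a * t) := by
  obtain ⟨a, ha, ha0⟩ := ((eventually_all.2 (eventually_exists_abs_apply_le hC hbdd hdiag)).and
    self_mem_nhdsWithin).exists
  choose K hK0 hK using ha
  have hsum0 : 0 ≤ ∑ i, K i := Finset.sum_nonneg fun i _ => hK0 i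
  refine ⟨∑ i, K i, hsum0, a, ha0, fun η hη t ht => ?_⟩
  refine (pi_norm_le_iff_of_nonneg (by positivity)).2 fun i => (hK i η hη t ht).trans ?_
  gcongr
  exact Finset.single_le_sum (fun i _ => hK0 i) (Finset.mem_univ i)

end Decay

section EuclideanNorm

variable {m n : ℕ}

theorem enorm2_nonneg (v : Fin n → ℝ) : 0 ≤ enorm2 v := norm_nonneg _

theorem abs_apply_le_enorm2 (v : Fin n → ℝ) (i : Fin n) : |v i| ≤ enorm2 v :=
  PiLp.norm_apply_le (WithLp.toLp 2 v) i

theorem norm_le_enorm2 (v : Fin n → ℝ) : ‖v‖ ≤ enorm2 v :=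
  (pi_norm_le_iff_of_nonneg (enorm2_nonneg v)).2 (abs_apply_le_enorm2 v)

theorem enorm2_le_sqrt_mul_norm (v : Fin n → ℝ) : enorm2 v ≤ √n * ‖v‖ := by
  rw [enorm2, EuclideanSpace.norm_eq, ← Real.sqrt_sq (norm_nonneg v), ← Real.sqrt_mul n.cast_nonneg]
  gcongr
  calc ∑ i, ‖v i‖ ^ 2 ≤ ∑ _i : Fin n, ‖v‖ ^ 2 := by
        gcongr with i
        exact norm_le_pi_norm v i
    _ = n * ‖v‖ ^ 2 := by simp

theorem enorm2_single (j : Fin n) : enorm2 (Pi.single j 1) = 1 := by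
  simp [enorm2]

theorem enorm2_sq (v : Fin n → ℝ) : enorm2 v ^ 2 = v ⬝ᵥ v := by
  rw [enorm2, EuclideanSpace.real_norm_sq_eq]
  simp only [dotProduct, sq]

theorem enorm2_mulVec {U : Matrix (Fin m) (Fin n) ℝ} (hU : Uᵀ * U = 1) (v : Fin n → ℝ) :
    enorm2 (U *ᵥ v) = enorm2 v := by
  rw [← sq_eq_sq₀ (enorm2_nonneg _) (enorm2_nonneg _), enorm2_sq, enorm2_sq, dotProduct_mulVec,
    ← mulVec_transpose, mulVec_mulVec, hU, one_mulVec]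

theorem BoundedInTime.essBounded {M : ℝ → Matrix (Fin m) (Fin n) ℝ} (hM : BoundedInTime M)
    (hmeas : ∀ i j, AEStronglyMeasurable (fun t => M t i j) (volume.restrict (Ici 0))) :
    EssBounded M := by
  obtain ⟨K, hK⟩ := hM
  refine fun i j => memLp_top_of_bound (hmeas i j) K <|
    ae_restrict_of_forall_mem measurableSet_Ici fun t ht => ?_
  have hcol := (abs_apply_le_enorm2 _ i).trans (hK t ht _ (enorm2_single j))
  rwa [mulVec_single_one] at hcol

end EuclideanNorm

theorem isSolution_iff {n : ℕ} {F : ℝ → (Fin n → ℝ) → (Fin n → ℝ)} {x₀ : Fin n → ℝ}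
    {x : ℝ → Fin n → ℝ} : IsSolution F x₀ x ↔
      x 0 = x₀ ∧ ∀ i, IsAntideriv (fun t => x t i) fun t => F t (x t) i := by
  have integral_apply : ∀ {t : ℝ}, 0 ≤ t → ∀ {f : ℝ → Fin n → ℝ},
      IntervalIntegrable f volume 0 t →
      ∀ i, (∫ s in (0 : ℝ)..t, f s) i = ∫ s in (0 : ℝ)..t, f s i := by
    intro t ht f hf i
    rw [intervalIntegral.integral_of_le ht, intervalIntegral.integral_of_le ht]
    exact eval_integral (fun j => hf.1.eval j) i
  constructor
  · intro h
    obtain rfl : x 0 = x₀ := by simpa using (h 0 le_rfl).2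
    refine ⟨rfl, fun i => ⟨locallyIntegrableOn_Ici_iff.2 fun t ht =>
      ⟨(h t ht).1.1.eval i, (h t ht).1.2.eval i⟩, fun t ht => ?_⟩⟩
    rw [← integral_apply ht (h t ht).1 i]
    exact congrFun (h t ht).2 i
  · rintro ⟨rfl, h⟩ t ht
    have hint : IntervalIntegrable (fun s => F s (x s)) volume 0 t :=
      ⟨Integrable.of_eval fun i => ((h i).intervalIntegrable ht).1,
        Integrable.of_eval fun i => ((h i).intervalIntegrable ht).2⟩
    refine ⟨hint, funext fun i => ?_⟩
    rw [Pi.add_apply, integral_apply ht hint i]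
    exact (h i).eq_add_integral t ht

section SkewOfLower

variable {k : ℕ}

theorem skewOfLower_transpose (M : Matrix (Fin k) (Fin k) ℝ) :
    (skewOfLower M)ᵀ = -skewOfLower M := by
  ext i j
  rcases lt_trichotomy i j with h | rfl | h
  · simp [skewOfLower, h, h.not_gt]
  · simp [skewOfLower]
  · simp [skewOfLower, h, h.not_gt]

theorem isUpperTriangular_sub_skewOfLower (M : Matrix (Fin k) (Fin k) ℝ) :
    (M - skewOfLower M).IsUpperTriangular := by
  intro i j (h : j < i)
  simp [skewOfLower, h]

theorem sub_skewOfLower_diag (M : Matrix (Fin k) (Fin k) ℝ) (i : Fin k) :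
    (M - skewOfLower M) i i = M i i := by
  simp [skewOfLower]

theorem essBounded_skewOfLower {M : ℝ → Matrix (Fin k) (Fin k) ℝ} (hM : EssBounded M) :
    EssBounded fun t => skewOfLower (M t) := fun i j => by
  simp only [skewOfLower, of_apply]
  split_ifs
  · exact hM i j
  · exact (hM j i).neg
  · exact MemLp.zero'

end SkewOfLower

/-- The coefficient matrix of the equation `ξ̇ = M ξ` in the moving frame `QQ` of the continuous QR
equation of `A`, that is, of the equation satisfied by the coordinates `QQᵀ ξ`. -/
def rotatedCoeff {d : ℕ} (A QQ M : ℝ → Matrix (Fin d) (Fin d) ℝ) (t : ℝ) :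
    Matrix (Fin d) (Fin d) ℝ :=
  (QQ t)ᵀ * M t * QQ t - skewOfLower ((QQ t)ᵀ * A t * QQ t)

section Frame

variable {d : ℕ} {A QQ M : ℝ → Matrix (Fin d) (Fin d) ℝ}

theorem isUpperTriangular_coeffB {k : ℕ} (A : ℝ → Matrix (Fin d) (Fin d) ℝ)
    (Q : ℝ → Matrix (Fin d) (Fin k) ℝ) (t : ℝ) : (coeffB A Q t).IsUpperTriangular :=
  isUpperTriangular_sub_skewOfLower _

namespace IsContinuousQR

theorem mul_transpose (hQQ : IsContinuousQR A QQ) {t : ℝ} (ht : 0 ≤ t) : QQ t * (QQ t)ᵀ = 1 :=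
  mul_eq_one_comm.1 (hQQ t ht).1

theorem essBounded {k : ℕ} {Q : ℝ → Matrix (Fin d) (Fin k) ℝ} (hQ : IsContinuousQR A Q) :
    EssBounded Q := by
  have hcont : ∀ i j, ContinuousOn (fun t => Q t i j) (Ici 0) :=
    fun i j t ht => ((hQ t ht).2 i j).continuousWithinAt
  have hbdd : BoundedInTime Q :=
    ⟨1, fun t ht x hx => by rw [enorm2_mulVec (hQ t ht).1, hx]⟩
  exact hbdd.essBounded fun i j => (hcont i j).aestronglyMeasurable measurableSet_Ici

theorem essBounded_conj (hQQ : IsContinuousQR A QQ) (hM : EssBounded M) :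
    EssBounded fun t => (QQ t)ᵀ * M t * QQ t :=
  (hQQ.essBounded.transpose.mul hM).mul hQQ.essBounded

theorem essBounded_rotatedCoeff (hQQ : IsContinuousQR A QQ) (hA : EssBounded A)
    (hM : EssBounded M) : EssBounded (rotatedCoeff A QQ M) :=
  (hQQ.essBounded_conj hM).sub (essBounded_skewOfLower (hQQ.essBounded_conj hA))

theorem isAntideriv (hQQ : IsContinuousQR A QQ) (hA : EssBounded A) (i j : Fin d) :
    IsAntideriv (fun t => QQ t i j)
      fun t => (QQ t * skewOfLower ((QQ t)ᵀ * A t * QQ t)) i j := by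
  refine isAntideriv_of_hasDerivWithinAt
    ((hQQ.essBounded.mul (essBounded_skewOfLower (hQQ.essBounded_conj hA))).locallyIntegrableOn i j)
    fun t ht => ?_
  have hderiv := (hQQ t ht).2 i j
  rwa [qrField, hQQ.mul_transpose ht, sub_self, Matrix.zero_mul, Matrix.zero_mul, zero_add]
    at hderiv

theorem enorm2_transpose_mulVec (hQQ : IsContinuousQR A QQ) {t : ℝ} (ht : 0 ≤ t) (w : Fin d → ℝ) :
    enorm2 ((QQ t)ᵀ *ᵥ w) = enorm2 w :=
  enorm2_mulVec (by rw [transpose_transpose, hQQ.mul_transpose ht]) w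

end IsContinuousQR

theorem SolvesLinear.transpose_mulVec {ξ : ℝ → Fin d → ℝ} (hξ : SolvesLinear M ξ)
    (hQQ : IsContinuousQR A QQ) (hA : EssBounded A) :
    SolvesLinear (rotatedCoeff A QQ M) fun t => (QQ t)ᵀ *ᵥ ξ t := by
  intro i
  refine (IsAntideriv.sum Finset.univ fun j _ =>
    (hQQ.isAntideriv hA j i).mul (hξ j)).congr (fun _ _ => rfl) fun t ht => ?_
  have hproduct_rule : rotatedCoeff A QQ M t *ᵥ ((QQ t)ᵀ *ᵥ ξ t) =
      (QQ t * skewOfLower ((QQ t)ᵀ * A t * QQ t))ᵀ *ᵥ ξ t + (QQ t)ᵀ *ᵥ (M t *ᵥ ξ t) := by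
    rw [transpose_mul, skewOfLower_transpose, mulVec_mulVec, mulVec_mulVec, ← add_mulVec,
      rotatedCoeff, Matrix.sub_mul, Matrix.mul_assoc _ (QQ t), hQQ.mul_transpose ht,
      Matrix.mul_one, Matrix.neg_mul, neg_add_eq_sub]
  rw [hproduct_rule]
  exact Finset.sum_add_distrib

theorem SolvesLinear.mulVec {η : ℝ → Fin d → ℝ} (hη : SolvesLinear (rotatedCoeff A QQ M) η)
    (hQQ : IsContinuousQR A QQ) (hA : EssBounded A) :
    SolvesLinear M fun t => QQ t *ᵥ η t := by
  intro i
  refine (IsAntideriv.sum Finset.univ fun j _ =>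
    (hQQ.isAntideriv hA i j).mul (hη j)).congr (fun _ _ => rfl) fun t ht => ?_
  have hproduct_rule : M t *ᵥ (QQ t *ᵥ η t) =
      (QQ t * skewOfLower ((QQ t)ᵀ * A t * QQ t)) *ᵥ η t +
        QQ t *ᵥ (rotatedCoeff A QQ M t *ᵥ η t) := by
    rw [mulVec_mulVec, mulVec_mulVec, ← add_mulVec, rotatedCoeff, Matrix.mul_sub,
      add_sub_cancel, Matrix.mul_assoc _ (M t), ← Matrix.mul_assoc, hQQ.mul_transpose ht,
      Matrix.one_mul]
  rw [hproduct_rule]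
  exact Finset.sum_add_distrib

end Frame

section GramSchmidt

variable {𝕜 E ι α : Type*} [RCLike 𝕜] [NormedAddCommGroup E] [InnerProductSpace 𝕜 E]
  [LinearOrder ι] [LocallyFiniteOrderBot ι] [WellFoundedLT ι]

open InnerProductSpace

theorem norm_gramSchmidtNormed_le_one (f : ι → E) (i : ι) : ‖gramSchmidtNormed 𝕜 f i‖ ≤ 1 := by
  by_cases h : gramSchmidtNormed 𝕜 f i = 0
  · simp [h]
  · exact (gramSchmidtNormed_unit_length' h).le

theorem inner_gramSchmidt_apply_self (f : ι → E) (i : ι) :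
    inner 𝕜 (gramSchmidt 𝕜 f i) (f i) = (‖gramSchmidt 𝕜 f i‖ : 𝕜) ^ 2 := by
  rw [gramSchmidt_def'' 𝕜 f i, inner_add_right, inner_sum, Finset.sum_eq_zero, add_zero,
    inner_self_eq_norm_sq_to_K]
  intro l hl
  rw [inner_smul_right, gramSchmidt_orthogonal 𝕜 f (Finset.mem_Iio.1 hl).ne', mul_zero]

theorem aestronglyMeasurable_gramSchmidt [MeasurableSpace α] {μ : Measure α} {f : α → ι → E}
    (hf : ∀ i, AEStronglyMeasurable (fun t => f t i) μ) (i : ι) :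
    AEStronglyMeasurable (fun t => gramSchmidt 𝕜 (f t) i) μ := by
  induction i using WellFoundedLT.induction with
  | ind i ih =>
    simp only [gramSchmidt_def 𝕜 _ i, Submodule.starProjection_singleton]
    refine (hf i).sub (Finset.aestronglyMeasurable_fun_sum _ fun l hl => ?_)
    have hl := ih l (Finset.mem_Iio.1 hl)
    exact ((hl.inner (hf i)).div₀ (RCLike.continuous_ofReal.comp_aestronglyMeasurable
      (hl.norm.pow 2))).smul hl

theorem aestronglyMeasurable_gramSchmidtNormed [MeasurableSpace α] {μ : Measure α}
    {f : α → ι → E} (hf : ∀ i, AEStronglyMeasurable (fun t => f t i) μ) (i : ι) :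
    AEStronglyMeasurable (fun t => gramSchmidtNormed 𝕜 (f t) i) μ :=
  (RCLike.continuous_ofReal.comp_aestronglyMeasurable
    (aestronglyMeasurable_gramSchmidt hf i).norm).inv₀.smul (aestronglyMeasurable_gramSchmidt hf i)

end GramSchmidt

section ThinQR

variable {d k : ℕ}

/-- The columns of `Y` as vectors of the Euclidean space in which they are orthonormalised. -/
def euclideanColumn (Y : Matrix (Fin d) (Fin k) ℝ) (j : Fin k) : EuclideanSpace ℝ (Fin d) :=
  WithLp.toLp 2 fun i => Y i j

theorem essBounded_thinQ {Y : ℝ → Matrix (Fin d) (Fin k) ℝ} (hY : EssBounded Y) :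
    EssBounded fun t => thinQ (Y t) := fun i j => by
  have hcol : ∀ l, AEStronglyMeasurable (fun t => euclideanColumn (Y t) l)
      (volume.restrict (Ici 0)) := fun l =>
    (PiLp.continuous_toLp 2 _).comp_aestronglyMeasurable
      (aemeasurable_pi_iff.2 fun m => (hY m l).1.aemeasurable).aestronglyMeasurable
  refine memLp_top_of_bound ((PiLp.continuous_apply 2 _ i).comp_aestronglyMeasurable
    (aestronglyMeasurable_gramSchmidtNormed (𝕜 := ℝ) hcol j)) 1 (ae_of_all _ fun t => ?_)
  exact (PiLp.norm_apply_le (InnerProductSpace.gramSchmidtNormed ℝ (euclideanColumn (Y t)) j)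
    i).trans (norm_gramSchmidtNormed_le_one _ j)

theorem thinR_apply (Y : Matrix (Fin d) (Fin k) ℝ) (i j : Fin k) :
    thinR Y i j = ‖InnerProductSpace.gramSchmidt ℝ (euclideanColumn Y) i‖⁻¹ *
      inner ℝ (InnerProductSpace.gramSchmidt ℝ (euclideanColumn Y) i) (euclideanColumn Y j) := by
  have hinner : thinR Y i j = inner ℝ
      (InnerProductSpace.gramSchmidtNormed ℝ (euclideanColumn Y) i) (euclideanColumn Y j) := by
    rw [PiLp.inner_apply, thinR, mul_apply]
    exact Finset.sum_congr rfl fun m _ => mul_comm _ _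
  rw [hinner, InnerProductSpace.gramSchmidtNormed, inner_smul_left]
  simp

theorem isUpperTriangular_thinR (Y : Matrix (Fin d) (Fin k) ℝ) : (thinR Y).IsUpperTriangular := by
  intro i j (hji : j < i)
  rw [thinR_apply, InnerProductSpace.gramSchmidt_inv_triangular ℝ _ hji, mul_zero]

theorem thinR_diag_nonneg (Y : Matrix (Fin d) (Fin k) ℝ) (j : Fin k) : 0 ≤ thinR Y j j := by
  rw [thinR_apply, inner_gramSchmidt_apply_self]
  positivity

end ThinQR

/-- The coefficient matrix `A - L H` of the equation for the estimation error. -/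
def errorCoeff {d k s : ℕ} (A : ℝ → Matrix (Fin d) (Fin d) ℝ) (H : ℝ → Matrix (Fin s) (Fin d) ℝ)
    (Q : ℝ → Matrix (Fin d) (Fin k) ℝ) (p t : ℝ) : Matrix (Fin d) (Fin d) ℝ :=
  A t - gain H Q p t * H t

section ErrorCoeff

variable {d k s : ℕ} {hkd : k ≤ d} {A QQ : ℝ → Matrix (Fin d) (Fin d) ℝ}
  {H : ℝ → Matrix (Fin s) (Fin d) ℝ} {Q : ℝ → Matrix (Fin d) (Fin k) ℝ}

theorem essBounded_observedBasis (hH : EssBounded H) (hQ : EssBounded Q) :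
    EssBounded (observedBasis H Q) :=
  (hH.transpose.mul hH).mul hQ

theorem essBounded_thinR_observedBasis (hH : EssBounded H) (hQ : EssBounded Q) :
    EssBounded fun t => thinR (observedBasis H Q t) :=
  have hY := essBounded_observedBasis hH hQ
  (essBounded_thinQ hY).transpose.mul hY

theorem essBounded_errorCoeff (hA : EssBounded A) (hH : EssBounded H) (hQ : EssBounded Q) (p : ℝ) :
    EssBounded (errorCoeff A H Q p) :=
  have hQt := (essBounded_thinQ (essBounded_observedBasis hH hQ)).transpose
  hA.sub ((((hQ.mul hQt).mul hH.transpose).const_smul p).mul hH)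

theorem errorCoeff_mulVec (p t : ℝ) (z x : Fin d → ℝ) :
    errorCoeff A H Q p t *ᵥ (z - x) =
      A t *ᵥ z - (A t *ᵥ x + gain H Q p t *ᵥ (H t *ᵥ z - H t *ᵥ x)) := by
  rw [errorCoeff, sub_mulVec, mulVec_sub, ← mulVec_mulVec, mulVec_sub (H t)]
  abel

theorem submatrix_one_mul_apply {m n r : Type*} [Fintype m] [DecidableEq n] {e : m → n}
    (he : Function.Injective e) (X : Matrix m r ℝ) (i : m) (j : r) :
    ((1 : Matrix n n ℝ).submatrix id e * X) (e i) j = X i j := by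
  classical
  simp [Matrix.mul_apply, Matrix.one_apply, he.eq_iff]

theorem submatrix_one_mul_apply_of_notMem_range {m n r : Type*} [Fintype m] [DecidableEq n]
    {e : m → n} (X : Matrix m r ℝ) {i : n} (hi : i ∉ range e) (j : r) :
    ((1 : Matrix n n ℝ).submatrix id e * X) i j = 0 := by
  have hne : ∀ l, i ≠ e l := fun l h => hi ⟨l, h.symm⟩
  simp [Matrix.mul_apply, hne]

theorem coeffB_apply_self_of_leading {t : ℝ} (hlead : Q t = (QQ t).submatrix id (Fin.castLE hkd))
    (j : Fin k) : coeffB A Q t j j = coeffB A QQ t (Fin.castLE hkd j) (Fin.castLE hkd j) := by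
  simp only [coeffB, sub_skewOfLower_diag, hlead]
  rfl

theorem rotatedCoeff_errorCoeff {t : ℝ} (hQQ : (QQ t)ᵀ * QQ t = 1)
    (hlead : Q t = (QQ t).submatrix id (Fin.castLE hkd)) (p : ℝ) :
    rotatedCoeff A QQ (errorCoeff A H Q p) t = coeffB A QQ t -
      p • ((1 : Matrix (Fin d) (Fin d) ℝ).submatrix id (Fin.castLE hkd) *
        ((thinQ (observedBasis H Q t))ᵀ * ((H t)ᵀ * H t * QQ t))) := by
  have hcols : (1 : Matrix (Fin d) (Fin d) ℝ).submatrix id (Fin.castLE hkd) = (QQ t)ᵀ * Q t := by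
    rw [hlead, ← hQQ]
    rfl
  simp only [hcols, rotatedCoeff, errorCoeff, coeffB, gain, Matrix.mul_sub, Matrix.sub_mul,
    Matrix.smul_mul, Matrix.mul_smul, Matrix.mul_assoc]
  abel

theorem rotatedCoeff_errorCoeff_apply_castLE {t : ℝ} (hQQ : (QQ t)ᵀ * QQ t = 1)
    (hlead : Q t = (QQ t).submatrix id (Fin.castLE hkd)) (p : ℝ) (i l : Fin k) :
    rotatedCoeff A QQ (errorCoeff A H Q p) t (Fin.castLE hkd i) (Fin.castLE hkd l) =
      coeffB A QQ t (Fin.castLE hkd i) (Fin.castLE hkd l) -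
        p * thinR (observedBasis H Q t) i l := by
  rw [rotatedCoeff_errorCoeff hQQ hlead, Matrix.sub_apply, Matrix.smul_apply,
    submatrix_one_mul_apply (Fin.castLE_injective hkd), smul_eq_mul, thinR]
  congr 2
  nth_rw 3 [observedBasis]
  rw [hlead]
  rfl

theorem rotatedCoeff_errorCoeff_apply_of_le {t : ℝ} (hQQ : (QQ t)ᵀ * QQ t = 1)
    (hlead : Q t = (QQ t).submatrix id (Fin.castLE hkd)) (p : ℝ) {i : Fin d} (hi : k ≤ i)
    (l : Fin d) :
    rotatedCoeff A QQ (errorCoeff A H Q p) t i l = coeffB A QQ t i l := by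
  have hrange : i ∉ range (Fin.castLE hkd) := by
    rintro ⟨j, rfl⟩
    exact hi.not_gt j.2
  rw [rotatedCoeff_errorCoeff hQQ hlead, Matrix.sub_apply, Matrix.smul_apply,
    submatrix_one_mul_apply_of_notMem_range _ hrange, smul_zero, sub_zero]

theorem isUpperTriangular_rotatedCoeff_errorCoeff {t : ℝ} (hQQ : (QQ t)ᵀ * QQ t = 1)
    (hlead : Q t = (QQ t).submatrix id (Fin.castLE hkd)) (p : ℝ) :
    (rotatedCoeff A QQ (errorCoeff A H Q p) t).IsUpperTriangular := by
  intro i l (hli : l < i)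
  rcases lt_or_ge (i : ℕ) k with hi | hi
  · obtain ⟨i', rfl⟩ : ∃ i' : Fin k, i = Fin.castLE hkd i' := ⟨⟨i, hi⟩, rfl⟩
    obtain ⟨l', rfl⟩ : ∃ l' : Fin k, l = Fin.castLE hkd l' :=
      ⟨⟨l, (Fin.lt_def.1 hli).trans hi⟩, rfl⟩
    have hB : coeffB A QQ t (Fin.castLE hkd i') (Fin.castLE hkd l') = 0 :=
      isUpperTriangular_coeffB A QQ t hli
    have hR : thinR (observedBasis H Q t) i' l' = 0 := isUpperTriangular_thinR _ hli
    rw [rotatedCoeff_errorCoeff_apply_castLE hQQ hlead, hB, hR, mul_zero, sub_zero]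
  · rw [rotatedCoeff_errorCoeff_apply_of_le hQQ hlead p hi, isUpperTriangular_coeffB A QQ t hli]

end ErrorCoeff

section TimeAverage

variable {f g : ℝ → ℝ} {b b' : ℝ}

theorem timeAverage_eventuallyEq (hfg : EqOn f g (Ici 0)) :
    timeAverage f =ᶠ[atTop] timeAverage g := by
  filter_upwards [eventually_ge_atTop 0] with t ht
  rw [timeAverage, timeAverage, intervalIntegral_congr_of_eqOn_Ici hfg ht]

theorem timeAverage_sub_const_mul (hf : LocallyIntegrableOn f (Ici 0))
    (hg : LocallyIntegrableOn g (Ici 0)) (p : ℝ) {t : ℝ} (ht : 0 ≤ t) :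
    timeAverage (fun s => f s - p * g s) t = timeAverage f t - p * timeAverage g t := by
  rw [locallyIntegrableOn_Ici_iff] at hf hg
  simp only [timeAverage]
  rw [intervalIntegral.integral_sub (hf t ht) ((hg t ht).const_mul p),
    intervalIntegral.integral_const_mul]
  ring

theorem eventually_log_div_lt (hpos : ∀ᶠ t in atTop, 0 < f t)
    (hf : f =O[atTop] fun t => Real.exp (b * t)) (hb : b < b') :
    ∀ᶠ t in atTop, 1 / t * Real.log (f t) < b' := by
  obtain ⟨K, hK, hKf⟩ := hf.exists_pos
  have hlim : Tendsto (fun t : ℝ => Real.log K / t + b) atTop (𝓝 b) := by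
    simpa using (tendsto_const_nhds.div_atTop tendsto_id).add_const b
  filter_upwards [hpos, hKf.bound, eventually_gt_atTop 0, hlim.eventually_lt_const hb]
    with t hft hle ht hlt
  refine lt_of_le_of_lt ?_ hlt
  rw [Real.norm_of_nonneg hft.le, Real.norm_of_nonneg (Real.exp_pos _).le] at hle
  calc 1 / t * Real.log (f t) ≤ 1 / t * Real.log (K * Real.exp (b * t)) := by gcongr
    _ = Real.log K / t + b := by
        rw [Real.log_mul hK.ne' (Real.exp_ne_zero _), Real.log_exp]
        field_simp

theorem eventually_timeAverage_lt
    (hf : (fun t => Real.exp (∫ s in (0 : ℝ)..t, f s)) =O[atTop] fun t => Real.exp (b * t))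
    (hb : b < b') : ∀ᶠ t in atTop, timeAverage f t < b' := by
  simpa only [timeAverage, Real.log_exp] using
    eventually_log_div_lt (Eventually.of_forall fun _ => Real.exp_pos _) hf hb

theorem isBoundedUnder_timeAverage (hf : MemLp f ⊤ (volume.restrict (Ici 0))) :
    IsBoundedUnder (· ≤ ·) atTop (timeAverage f) := by
  refine isBoundedUnder_of_eventually_le (a := lpNorm f ⊤ (volume.restrict (Ici 0))) ?_
  filter_upwards [eventually_gt_atTop 0] with t ht
  rw [timeAverage, one_div, inv_mul_le_iff₀ ht, mul_comm]
  refine (Real.le_norm_self _).trans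
    ((intervalIntegral.norm_integral_le_of_norm_le_const_ae ?_).trans_eq
      (by rw [sub_zero, abs_of_pos ht]))
  filter_upwards [(ae_restrict_iff' measurableSet_Ici).1 (ae_le_lpNorm_exponent_top hf)]
    with s hs hst
  rw [uIoc_of_le ht.le] at hst
  exact hs hst.1.le

end TimeAverage

section LyapunovExponent

variable {d : ℕ} {A Φ QQ : ℝ → Matrix (Fin d) (Fin d) ℝ} {v : Fin d → ℝ} {c : ℝ}

/-- The initial values whose orbits under `Φ` grow at most like `e^{c t}`. Up to the value of `c`
these are the subspaces of the Lyapunov filtration. -/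
def growthSubspace (Φ : ℝ → Matrix (Fin d) (Fin d) ℝ) (c : ℝ) : Submodule ℝ (Fin d → ℝ) where
  carrier := {v | (fun t => Φ t *ᵥ v) =O[atTop] fun t => Real.exp (c * t)}
  zero_mem' := by
    simpa only [mem_ofPred_eq, mulVec_zero] using Asymptotics.isBigO_zero _ _
  add_mem' hv hw := by simpa only [mem_ofPred_eq, mulVec_add] using hv.add hw
  smul_mem' a v hv := by
    simp only [mem_ofPred_eq, mulVec_smul]
    exact hv.const_smul_left a

theorem mem_growthSubspace : v ∈ growthSubspace Φ c ↔
    (fun t => Φ t *ᵥ v) =O[atTop] fun t => Real.exp (c * t) :=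
  Iff.rfl

theorem isBigO_enorm2 (w : ℝ → Fin d → ℝ) (l : Filter ℝ) : (fun t => enorm2 (w t)) =O[l] w :=
  .of_bound √d <| Eventually.of_forall fun t => by
    rw [Real.norm_of_nonneg (enorm2_nonneg _)]
    exact enorm2_le_sqrt_mul_norm _

theorem mem_growthSubspace_of_lyapunovExponent_lt (h : lyapunovExponent Φ v < c) :
    v ∈ growthSubspace Φ c := by
  rcases eq_or_ne v 0 with rfl | hv
  · exact zero_mem _
  rw [lyapunovExponent, if_neg hv] at h
  refine mem_growthSubspace.2 (.of_bound 1 ?_)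
  filter_upwards [eventually_lt_of_limsup_lt h, eventually_gt_atTop 0] with t hlt ht
  rw [EReal.coe_lt_coe_iff, one_div, inv_mul_lt_iff₀ ht] at hlt
  rw [one_mul, Real.norm_of_nonneg (Real.exp_pos _).le]
  refine (norm_le_enorm2 _).trans ?_
  rw [mul_comm c]
  exact (Real.le_exp_log _).trans (Real.exp_le_exp.2 hlt.le)

theorem IsFlow.solvesLinear (hΦ : IsFlow A Φ) (hA : EssBounded A) (v : Fin d → ℝ) :
    SolvesLinear A fun t => Φ t *ᵥ v := by
  have hderiv : ∀ t, 0 ≤ t → ∀ i,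
      HasDerivWithinAt (fun τ => (Φ τ *ᵥ v) i) ((A t *ᵥ (Φ t *ᵥ v)) i) (Ici 0) t := by
    intro t ht i
    rw [mulVec_mulVec]
    exact HasDerivWithinAt.fun_sum (u := Finset.univ) fun j _ => (hΦ.2 t ht i j).mul_const (v j)
  refine fun i => isAntideriv_of_hasDerivWithinAt ?_ fun t ht => hderiv t ht i
  exact locallyIntegrableOn_finsetSum Finset.univ fun j _ =>
    (hA.locallyIntegrableOn i j).mul_continuousOn
      (fun t ht => (hderiv t ht j).continuousWithinAt) isLocallyClosed_Ici

theorem IsFlow.mulVec_ne_zero (hΦ : IsFlow A Φ) (hA : EssBounded A) (hQQ : IsContinuousQR A QQ)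
    (hv : v ≠ 0) {t : ℝ} (ht : 0 ≤ t) : Φ t *ᵥ v ≠ 0 := by
  intro hzero
  have hη : SolvesLinear (coeffB A QQ) fun t => (QQ t)ᵀ *ᵥ (Φ t *ᵥ v) :=
    (hΦ.solvesLinear hA v).transpose_mulVec hQQ hA
  have h0 : (QQ 0)ᵀ *ᵥ (Φ 0 *ᵥ v) = 0 := funext fun i =>
    hη.eq_zero_of_isUpperSet (fun t _ => isUpperTriangular_coeffB A QQ t)
      (hQQ.essBounded_rotatedCoeff hA hA).locallyIntegrableOn isUpperSet_univ ht
      (fun i _ => by rw [hzero, mulVec_zero, Pi.zero_apply]) i (mem_univ i) 0 le_rfl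
  apply hv
  calc v = QQ 0 *ᵥ ((QQ 0)ᵀ *ᵥ (Φ 0 *ᵥ v)) := by
        rw [mulVec_mulVec, hQQ.mul_transpose le_rfl, one_mulVec, hΦ.1, one_mulVec]
    _ = 0 := by rw [h0, mulVec_zero]

theorem IsFlow.lyapunovExponent_le (hΦ : IsFlow A Φ) (hA : EssBounded A)
    (hQQ : IsContinuousQR A QQ) (hv : v ∈ growthSubspace Φ c) : lyapunovExponent Φ v ≤ c := by
  rcases eq_or_ne v 0 with rfl | hv0
  · simp [lyapunovExponent]
  rw [lyapunovExponent, if_neg hv0]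
  refine EReal.le_of_forall_lt_iff_le.1 fun b hb => limsup_le_of_le (h := ?_)
  have hpos : ∀ᶠ t in atTop, 0 < enorm2 (Φ t *ᵥ v) := by
    filter_upwards [eventually_ge_atTop 0] with t ht
    exact (norm_pos_iff.2 (hΦ.mulVec_ne_zero hA hQQ hv0 ht)).trans_le (norm_le_enorm2 _)
  filter_upwards [eventually_log_div_lt hpos ((isBigO_enorm2 _ _).trans hv)
    (EReal.coe_lt_coe_iff.1 hb)] with t ht
  exact EReal.coe_le_coe_iff.2 ht.le

theorem IsLyapunovSpectrum.exists_neg_le_finrank_growthSubspace {lam : Fin d → ℝ}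
    (hlam : IsLyapunovSpectrum Φ lam) : ∃ c < 0,
      d ≤ (Finset.univ.filter fun i => 0 ≤ lam i).card + Module.finrank ℝ (growthSubspace Φ c) := by
  obtain ⟨c, hc, hc0⟩ : ∃ c, (∀ i, lam i < 0 → lam i ≤ c) ∧ c < 0 := by
    refine ((eventually_all.2 fun i => ?_).and self_mem_nhdsWithin).exists (f := 𝓝[<] 0)
    by_cases hi : lam i < 0
    · filter_upwards [mem_nhdsWithin_of_mem_nhds (lt_mem_nhds hi)] with c hc _ using hc.le
    · simp [hi]
  have hsplit := Finset.card_filter_add_card_filter_not (s := (Finset.univ : Finset (Fin d)))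
    (fun i => 0 ≤ lam i)
  have hcard : (Finset.univ.filter fun i => ¬0 ≤ lam i).card ≤
      Module.finrank ℝ (Submodule.span ℝ {v | lyapunovExponent Φ v ≤ c}) := by
    rw [← hlam.2 c]
    exact Finset.card_le_card <| Finset.monotone_filter_right _ fun i _ hi => hc i (not_le.1 hi)
  have hspan : Submodule.span ℝ {v | lyapunovExponent Φ v ≤ c} ≤ growthSubspace Φ (c / 2) :=
    Submodule.span_le.2 fun v hv => mem_growthSubspace_of_lyapunovExponent_lt
      (lt_of_le_of_lt hv (EReal.coe_lt_coe_iff.2 (by linarith)))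
  refine ⟨c / 2, by linarith, ?_⟩
  rw [Finset.card_univ, Fintype.card_fin] at hsplit
  have := Submodule.finrank_mono hspan
  omega

end LyapunovExponent

section StableDirections

variable {d k : ℕ} {hkd : k ≤ d} {A Φ QQ : ℝ → Matrix (Fin d) (Fin d) ℝ} {c : ℝ}

theorem IsFlow.growthSubspace_sup_range_eq_top (hΦ : IsFlow A Φ) (hA : EssBounded A)
    (hQQ : IsContinuousQR A QQ) (hc : c < 0) {P : Matrix (Fin d) (Fin k) ℝ}
    (hP : ∀ u, u ≠ 0 → 0 ≤ lyapunovExponent Φ (P *ᵥ u))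
    (hdim : d ≤ k + Module.finrank ℝ (growthSubspace Φ c)) :
    growthSubspace Φ c ⊔ P.mulVecLin.range = ⊤ := by
  have hzero : ∀ u, P *ᵥ u ∈ growthSubspace Φ c → u = 0 := fun u hu => by
    by_contra hu0
    have hlt := (hP u hu0).trans (hΦ.lyapunovExponent_le hA hQQ hu)
    exact absurd (EReal.coe_nonneg.1 hlt) hc.not_ge
  have hinj : Function.Injective P.mulVecLin := (injective_iff_map_eq_zero _).2 fun u hu =>
    hzero u (by rw [← mulVecLin_apply, hu]; exact zero_mem _)
  refine Submodule.eq_top_of_disjoint _ _ ?_ ?_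
  · rw [LinearMap.finrank_range_of_inj hinj]
    simp only [Module.finrank_fintype_fun_eq_card, Fintype.card_fin]
    omega
  · rw [Submodule.disjoint_def]
    rintro _ hx ⟨u, rfl⟩
    rw [hzero u hx, map_zero]

theorem exists_mem_transpose_mulVec_eq {P : Matrix (Fin d) (Fin d) ℝ} (hP : Pᵀ * P = 1)
    {V : Submodule ℝ (Fin d → ℝ)}
    (hV : V ⊔ (P.submatrix id (Fin.castLE hkd)).mulVecLin.range = ⊤) (v : Fin d → ℝ) :
    ∃ w ∈ V, ∀ i : Fin d, k ≤ i → (Pᵀ *ᵥ w) i = v i := by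
  obtain ⟨w, hw, _, ⟨u, rfl⟩, hsum⟩ := Submodule.mem_sup.1 (hV ▸ Submodule.mem_top : P *ᵥ v ∈ _)
  refine ⟨w, hw, fun i hi => ?_⟩
  have hcols : Pᵀ * P.submatrix id (Fin.castLE hkd) =
      (1 : Matrix (Fin d) (Fin d) ℝ).submatrix id (Fin.castLE hkd) := by
    rw [← hP]
    rfl
  have hne : ∀ j, i ≠ Fin.castLE hkd j := by
    rintro j rfl
    exact hi.not_gt j.2
  rw [eq_sub_of_add_eq hsum, mulVec_sub, mulVecLin_apply, mulVec_mulVec, mulVec_mulVec, hP, hcols,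
    one_mulVec]
  simp [mulVec, dotProduct, hne]

theorem IsFlow.timeAverage_coeffB_limit_neg (hΦ : IsFlow A Φ) (hA : EssBounded A)
    (hQQ : IsContinuousQR A QQ) (hc : c < 0)
    (htop : growthSubspace Φ c ⊔ ((QQ 0).submatrix id (Fin.castLE hkd)).mulVecLin.range = ⊤)
    {i : Fin d} (hi : k ≤ i) {l : ℝ}
    (hl : Tendsto (timeAverage fun s => coeffB A QQ s i i) atTop (𝓝 l)) : l < 0 := by
  obtain ⟨w, hw, hwi⟩ := exists_mem_transpose_mulVec_eq (hQQ 0 le_rfl).1 htop (Pi.single i 1)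
  have hη : SolvesLinear (coeffB A QQ) fun t => (QQ t)ᵀ *ᵥ (Φ t *ᵥ w) :=
    (hΦ.solvesLinear hA w).transpose_mulVec hQQ hA
  have hη0 : ∀ m : Fin d, k ≤ m →
      ((QQ 0)ᵀ *ᵥ (Φ 0 *ᵥ w)) m = (Pi.single i 1 : Fin d → ℝ) m := fun m hm => by
    rw [hΦ.1, one_mulVec, hwi m hm]
  have hηi : ∀ t, 0 ≤ t →
      ((QQ t)ᵀ *ᵥ (Φ t *ᵥ w)) i = Real.exp (∫ s in (0 : ℝ)..t, coeffB A QQ s i i) :=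
    fun t ht => by
      refine (hη.eq_mul_exp (fun t _ => isUpperTriangular_coeffB A QQ t)
        (hQQ.essBounded_rotatedCoeff hA hA).locallyIntegrableOn
        (fun m hm => ?_) ht).trans ?_
      · rw [hη0 m (hi.trans hm.le), Pi.single_eq_of_ne hm.ne']
      · rw [hη0 i hi, Pi.single_eq_same, one_mul]
  have hexp : (fun t => Real.exp (∫ s in (0 : ℝ)..t, coeffB A QQ s i i)) =O[atTop]
      fun t => Real.exp (c * t) := by
    refine .trans (.of_bound 1 ?_) ((isBigO_enorm2 _ _).trans hw)
    filter_upwards [eventually_ge_atTop 0] with t ht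
    rw [← hηi t ht, one_mul, Real.norm_of_nonneg (enorm2_nonneg _),
      ← hQQ.enorm2_transpose_mulVec ht]
    exact abs_apply_le_enorm2 _ i
  have hlt := eventually_timeAverage_lt hexp (show c < c / 2 by linarith)
  linarith [le_of_tendsto hl (hlt.mono fun t => le_of_lt)]

end StableDirections

section ExponentialStability

variable {d k s : ℕ} {A Φ QQ C M : ℝ → Matrix (Fin d) (Fin d) ℝ}
  {H : ℝ → Matrix (Fin s) (Fin d) ℝ} {Q : ℝ → Matrix (Fin d) (Fin k) ℝ} {p : ℝ}

/-- All solutions of `η̇ = C(t) η` decay at a common exponential rate, with a constant that is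
proportional to the initial value. -/
def ExponentiallyStable (C : ℝ → Matrix (Fin d) (Fin d) ℝ) : Prop :=
  ∃ K > 0, ∃ a > 0, ∀ η, SolvesLinear C η →
    ∀ t, 0 ≤ t → enorm2 (η t) ≤ K * Real.exp (-a * t) * enorm2 (η 0)

theorem exponentiallyStable_of_isUpperTriangular (hC : ∀ t, 0 ≤ t → (C t).IsUpperTriangular)
    (hbdd : EssBounded C)
    (hdiag : ∀ i, ∃ m < 0, Tendsto (timeAverage fun t => C t i i) atTop (𝓝 m)) :
    ExponentiallyStable C := by
  obtain ⟨K, hK, a, ha, hdecay⟩ := exists_norm_le_mul_exp_neg hC hbdd hdiag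
  refine ⟨√d * K + 1, by positivity, a, ha, fun η hη t ht => ?_⟩
  calc enorm2 (η t) ≤ √d * (K * ‖η 0‖ * Real.exp (-a * t)) :=
        (enorm2_le_sqrt_mul_norm _).trans (by gcongr; exact hdecay η hη t ht)
    _ = √d * K * Real.exp (-a * t) * ‖η 0‖ := by ring
    _ ≤ (√d * K + 1) * Real.exp (-a * t) * enorm2 (η 0) := by
        gcongr
        · exact le_add_of_nonneg_right zero_le_one
        · exact norm_le_enorm2 _

theorem ExponentiallyStable.exists_eventually_timeAverage_lt (h : ExponentiallyStable C)
    (hC : ∀ t, 0 ≤ t → (C t).IsUpperTriangular)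
    (hint : ∀ i l, LocallyIntegrableOn (fun t => C t i l) (Ici 0)) :
    ∃ b < 0, ∀ i, ∀ᶠ t in atTop, timeAverage (fun s => C s i i) t < b := by
  obtain ⟨K, -, a, ha, hdecay⟩ := h
  refine ⟨-a / 2, by linarith, fun i => eventually_timeAverage_lt (b := -a) ?_ (by linarith)⟩
  obtain ⟨η, hη0, hη⟩ := exists_solvesLinear_of_isUpperTriangular hC hint (Pi.single i 1)
  refine .of_bound K ?_
  filter_upwards [eventually_ge_atTop 0] with t ht
  have hηi : η t i = Real.exp (∫ s in (0 : ℝ)..t, C s i i) := by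
    rw [hη.eq_mul_exp hC hint (fun l hl => by rw [hη0, Pi.single_eq_of_ne hl.ne']) ht, hη0,
      Pi.single_eq_same, one_mul]
  calc ‖Real.exp (∫ s in (0 : ℝ)..t, C s i i)‖ ≤ enorm2 (η t) := by
        rw [← hηi]
        exact abs_apply_le_enorm2 _ i
    _ ≤ K * Real.exp (-a * t) * enorm2 (η 0) := hdecay η hη t ht
    _ = K * ‖Real.exp (-a * t)‖ := by
        rw [hη0, enorm2_single, mul_one, Real.norm_of_nonneg (Real.exp_pos _).le]

theorem IsContinuousQR.exponentiallyStable_rotatedCoeff_iff (hQQ : IsContinuousQR A QQ)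
    (hA : EssBounded A) : ExponentiallyStable (rotatedCoeff A QQ M) ↔ ExponentiallyStable M := by
  refine ⟨fun ⟨K, hK, a, ha, h⟩ => ⟨K, hK, a, ha, fun ξ hξ t ht => ?_⟩,
    fun ⟨K, hK, a, ha, h⟩ => ⟨K, hK, a, ha, fun η hη t ht => ?_⟩⟩
  · simpa only [hQQ.enorm2_transpose_mulVec ht, hQQ.enorm2_transpose_mulVec le_rfl] using
      h _ (hξ.transpose_mulVec hQQ hA) t ht
  · simpa only [enorm2_mulVec (hQQ t ht).1, enorm2_mulVec (hQQ 0 le_rfl).1] using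
      h _ (hη.mulVec hQQ hA) t ht

theorem IsFlow.errorDecaysExponentially_iff (hΦ : IsFlow A Φ) (hA : EssBounded A) :
    ErrorDecaysExponentially A H (gain H Q p) ↔ ExponentiallyStable (errorCoeff A H Q p) := by
  refine ⟨fun ⟨K, hK, a, ha, h⟩ => ⟨K, hK, a, ha, fun ξ hξ => ?_⟩,
    fun ⟨K, hK, a, ha, h⟩ => ⟨K, hK, a, ha, fun v z x hz hx => h (fun t => z t - x t) ?_⟩⟩
  · have hz := hΦ.solvesLinear hA (ξ 0)
    have hz0 : Φ 0 *ᵥ ξ 0 = ξ 0 := by rw [hΦ.1, one_mulVec]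
    have hx : IsSolution (fun t w => A t *ᵥ w +
        gain H Q p t *ᵥ (H t *ᵥ (Φ t *ᵥ ξ 0) - H t *ᵥ w)) 0 fun t => Φ t *ᵥ ξ 0 - ξ t := by
      refine isSolution_iff.2 ⟨by rw [hz0, sub_self], fun i =>
        ((hz i).sub (hξ i)).congr (fun _ _ => rfl) fun t _ => ?_⟩
      have hcoeff := errorCoeff_mulVec (A := A) (H := H) (Q := Q) p t (Φ t *ᵥ ξ 0)
        (Φ t *ᵥ ξ 0 - ξ t)
      rw [sub_sub_cancel] at hcoeff
      simp only [hcoeff, Pi.sub_apply, sub_sub_cancel]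
    simpa only [sub_sub_cancel] using h (ξ 0) _ _ (isSolution_iff.2 ⟨hz0, hz⟩) hx
  · exact fun i => (((isSolution_iff.1 hz).2 i).sub ((isSolution_iff.1 hx).2 i)).congr
      (fun _ _ => rfl) fun t _ => congrFun (errorCoeff_mulVec p t (z t) (x t)).symm i

end ExponentialStability

section Detectability

variable {d k s : ℕ} {hkd : k ≤ d} {A QQ : ℝ → Matrix (Fin d) (Fin d) ℝ}
  {H : ℝ → Matrix (Fin s) (Fin d) ℝ} {Q : ℝ → Matrix (Fin d) (Fin k) ℝ} {p : ℝ}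

theorem observability_nonneg (j : Fin k) {t : ℝ} (ht : 0 ≤ t) : 0 ≤ observability H Q j t :=
  mul_nonneg (by positivity)
    (intervalIntegral.integral_nonneg ht fun _ _ => thinR_diag_nonneg _ j)

theorem IsContinuousQR.essBounded_of_leading (hQQ : IsContinuousQR A QQ)
    (hlead : ∀ t, 0 ≤ t → Q t = (QQ t).submatrix id (Fin.castLE hkd)) : EssBounded Q :=
  (hQQ.essBounded.submatrix id (Fin.castLE hkd)).congr fun t ht => (hlead t ht).symm

theorem timeAverage_coeffB_of_leading
    (hlead : ∀ t, 0 ≤ t → Q t = (QQ t).submatrix id (Fin.castLE hkd)) (j : Fin k) :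
    timeAverage (fun t => coeffB A Q t j j) =ᶠ[atTop]
      timeAverage fun t => coeffB A QQ t (Fin.castLE hkd j) (Fin.castLE hkd j) :=
  timeAverage_eventuallyEq fun t ht => coeffB_apply_self_of_leading (hlead t ht) j

theorem timeAverage_rotatedCoeff_errorCoeff_castLE (hA : EssBounded A) (hH : EssBounded H)
    (hQQ : IsContinuousQR A QQ)
    (hlead : ∀ t, 0 ≤ t → Q t = (QQ t).submatrix id (Fin.castLE hkd)) (p : ℝ) (j : Fin k) :
    timeAverage (fun t => rotatedCoeff A QQ (errorCoeff A H Q p) t (Fin.castLE hkd j)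
        (Fin.castLE hkd j)) =ᶠ[atTop]
      fun t => timeAverage (fun t => coeffB A QQ t (Fin.castLE hkd j) (Fin.castLE hkd j)) t -
        p * observability H Q j t := by
  refine (timeAverage_eventuallyEq fun t ht => rotatedCoeff_errorCoeff_apply_castLE (hQQ t ht).1
    (hlead t ht) p j j).trans ?_
  filter_upwards [eventually_ge_atTop 0] with t ht
  exact timeAverage_sub_const_mul ((hQQ.essBounded_rotatedCoeff hA hA).locallyIntegrableOn _ _)
    ((essBounded_thinR_observedBasis hH (hQQ.essBounded_of_leading hlead)).locallyIntegrableOn j j)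
    p ht

theorem essBounded_rotatedCoeff_errorCoeff (hA : EssBounded A) (hH : EssBounded H)
    (hQQ : IsContinuousQR A QQ)
    (hlead : ∀ t, 0 ≤ t → Q t = (QQ t).submatrix id (Fin.castLE hkd)) (p : ℝ) :
    EssBounded (rotatedCoeff A QQ (errorCoeff A H Q p)) :=
  hQQ.essBounded_rotatedCoeff hA (essBounded_errorCoeff hA hH (hQQ.essBounded_of_leading hlead) p)

theorem detectable_of_exponentiallyStable (hA : EssBounded A) (hH : EssBounded H)
    (hQQ : IsContinuousQR A QQ)
    (hlead : ∀ t, 0 ≤ t → Q t = (QQ t).submatrix id (Fin.castLE hkd)) (hp : 0 < p)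
    (hstable : ExponentiallyStable (rotatedCoeff A QQ (errorCoeff A H Q p))) :
    Detectable A H Q := by
  rintro j ⟨l, hl0, hl⟩
  obtain ⟨b, hb, havg⟩ := hstable.exists_eventually_timeAverage_lt
    (fun t ht => isUpperTriangular_rotatedCoeff_errorCoeff (hQQ t ht).1 (hlead t ht) p)
    (essBounded_rotatedCoeff_errorCoeff hA hH hQQ hlead p).locallyIntegrableOn
  have hobs : ∀ᶠ t in atTop, -b / (2 * p) ≤ observability H Q j t := by
    filter_upwards [havg (Fin.castLE hkd j), hl.eventually_const_lt (by linarith : b / 2 < l),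
      timeAverage_coeffB_of_leading hlead j,
      timeAverage_rotatedCoeff_errorCoeff_castLE hA hH hQQ hlead p j] with t hlt hB hBQ hrot
    rw [div_le_iff₀ (by positivity)]
    linarith
  have hbdd : IsBoundedUnder (· ≤ ·) atTop (observability H Q j) := isBoundedUnder_timeAverage
    (essBounded_thinR_observedBasis hH (hQQ.essBounded_of_leading hlead) j j)
  exact (div_pos (neg_pos.2 hb) (by positivity)).trans_le
    (le_limsup_of_frequently_le hobs.frequently hbdd)

theorem eventually_sub_mul_neg {b r : ℝ} (hr : 0 ≤ r) (hbr : 0 ≤ b → 0 < r) :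
    ∀ᶠ p in atTop, b - p * r < 0 := by
  rcases hr.eq_or_lt with rfl | hr
  · have hb : b < 0 := not_le.1 fun hb => (hbr hb).false
    exact .of_forall fun p => by rwa [mul_zero, sub_zero]
  · filter_upwards [(tendsto_id.atTop_mul_const hr).eventually_gt_atTop b] with p hp
    exact sub_neg.2 hp

theorem exists_exponentiallyStable_of_detectable (hA : EssBounded A) (hH : EssBounded H)
    (hQQ : IsContinuousQR A QQ) (hreg : ForwardRegular A QQ)
    (hlead : ∀ t, 0 ≤ t → Q t = (QQ t).submatrix id (Fin.castLE hkd))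
    (htail : ∀ i : Fin d, k ≤ i → ∀ l,
      Tendsto (timeAverage fun t => coeffB A QQ t i i) atTop (𝓝 l) → l < 0)
    (hobs : ∀ j, ∃ r, Tendsto (observability H Q j) atTop (𝓝 r)) (hdet : Detectable A H Q) :
    ∃ p, 0 < p ∧ ExponentiallyStable (rotatedCoeff A QQ (errorCoeff A H Q p)) := by
  choose b hb using hreg
  choose r hr using hobs
  have hr0 : ∀ j, 0 ≤ r j := fun j =>
    ge_of_tendsto (hr j) ((eventually_ge_atTop 0).mono fun _ => observability_nonneg j)
  have hrpos : ∀ j, 0 ≤ b (Fin.castLE hkd j) → 0 < r j := fun j hj => (hr j).limsup_eq ▸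
    hdet j ⟨_, hj, (hb _).congr' (timeAverage_coeffB_of_leading hlead j).symm⟩
  obtain ⟨p, hneg, hp⟩ := ((eventually_all.2 fun j =>
    eventually_sub_mul_neg (hr0 j) (hrpos j)).and (eventually_gt_atTop 0)).exists
  refine ⟨p, hp, exponentiallyStable_of_isUpperTriangular
    (fun t ht => isUpperTriangular_rotatedCoeff_errorCoeff (hQQ t ht).1 (hlead t ht) p)
    (essBounded_rotatedCoeff_errorCoeff hA hH hQQ hlead p) fun i => ?_⟩
  rcases lt_or_ge (i : ℕ) k with hi | hi
  · exact ⟨_, hneg ⟨i, hi⟩, ((hb i).sub ((hr ⟨i, hi⟩).const_mul p)).congr'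
      (timeAverage_rotatedCoeff_errorCoeff_castLE hA hH hQQ hlead p ⟨i, hi⟩).symm⟩
  · exact ⟨b i, htail i hi _ (hb i), (hb i).congr' (timeAverage_eventuallyEq fun t ht =>
      (rotatedCoeff_errorCoeff_apply_of_le (hQQ t ht).1 (hlead t ht) p hi i).symm)⟩

end Detectability

theorem mainTheorem2_general {d k s : ℕ} (hkd : k ≤ d)
    (A : ℝ → Matrix (Fin d) (Fin d) ℝ) (H : ℝ → Matrix (Fin s) (Fin d) ℝ)
    (hA : EssBounded A) (hH : EssBounded H)
    (Φ : ℝ → Matrix (Fin d) (Fin d) ℝ) (hΦ : IsFlow A Φ)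
    (lam : Fin d → ℝ) (hlam : IsLyapunovSpectrum Φ lam)
    (hk : k = (Finset.univ.filter fun i => 0 ≤ lam i).card)
    (QQ : ℝ → Matrix (Fin d) (Fin d) ℝ) (hQQ : IsContinuousQR A QQ)
    (hreg : ForwardRegular A QQ)
    (Q : ℝ → Matrix (Fin d) (Fin k) ℝ)
    (hQlead : ∀ t, 0 ≤ t → ∀ i j, Q t i j = QQ t i (Fin.castLE hkd j))
    (hQ0 : ∀ u : Fin k → ℝ, u ≠ 0 → 0 ≤ lyapunovExponent Φ (Q 0 *ᵥ u)) :
    ((∃ p : ℝ, 0 < p ∧ ErrorDecaysExponentially A H (gain H Q p)) → Detectable A H Q) ∧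
    ((∀ j, ∃ c : ℝ, Tendsto (observability H Q j) atTop (𝓝 c)) →
      ((∃ p : ℝ, 0 < p ∧ ErrorDecaysExponentially A H (gain H Q p)) ↔ Detectable A H Q)) := by
  have hlead : ∀ t, 0 ≤ t → Q t = (QQ t).submatrix id (Fin.castLE hkd) := fun t ht =>
    Matrix.ext (hQlead t ht)
  have hstable : ∀ p, ErrorDecaysExponentially A H (gain H Q p) ↔
      ExponentiallyStable (rotatedCoeff A QQ (errorCoeff A H Q p)) := fun p =>
    (hΦ.errorDecaysExponentially_iff hA).trans (hQQ.exponentiallyStable_rotatedCoeff_iff hA).symm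
  simp only [hstable]
  have hnec : (∃ p, 0 < p ∧ ExponentiallyStable (rotatedCoeff A QQ (errorCoeff A H Q p))) →
      Detectable A H Q := fun ⟨_, hp, h⟩ =>
    detectable_of_exponentiallyStable hA hH hQQ hlead hp h
  obtain ⟨c, hc, hdim⟩ := hlam.exists_neg_le_finrank_growthSubspace
  have htop := hΦ.growthSubspace_sup_range_eq_top hA hQQ hc hQ0 (hk ▸ hdim)
  rw [hlead 0 le_rfl] at htop
  exact ⟨hnec, fun hobs => ⟨hnec, exists_exponentiallyStable_of_detectable hA hH hQQ hreg hlead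
    (fun _ hi _ hl => hΦ.timeAverage_coeffB_limit_neg hA hQQ hc htop hi hl) hobs⟩⟩

end LinearObserver

end

open LinearObserver in
theorem mainTheorem2 {d k s : ℕ} (hkd : k ≤ d)
    (A : ℝ → Matrix (Fin d) (Fin d) ℝ) (H : ℝ → Matrix (Fin s) (Fin d) ℝ)
    (hAcont : ∀ i j, ContinuousOn (fun t => A t i j) (Set.Ici 0))
    (hHmeas : ∀ i j, Measurable fun t => H t i j)
    (hA : BoundedInTime A) (hH : BoundedInTime H)
    -- the flow, the Lyapunov exponents, and the number `k` of non-negative ones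
    (Φ : ℝ → Matrix (Fin d) (Fin d) ℝ) (hΦ : IsFlow A Φ)
    (lam : Fin d → ℝ) (hlam : IsLyapunovSpectrum Φ lam)
    (hk : k = (Finset.univ.filter fun i => 0 ≤ lam i).card)
    -- the full and the thin continuous QR factors, and forward regularity
    (QQ : ℝ → Matrix (Fin d) (Fin d) ℝ) (hQQ : IsContinuousQR A QQ)
    (hreg : ForwardRegular A QQ)
    (Q : ℝ → Matrix (Fin d) (Fin k) ℝ) (hQ : IsContinuousQR A Q)
    (hQlead : ∀ t, 0 ≤ t → ∀ i j, Q t i j = QQ t i (Fin.castLE hkd j))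
    -- the span of the initial columns is transversal to the stable subspace
    (hQ0 : ∀ u : Fin k → ℝ, u ≠ 0 → 0 ≤ lyapunovExponent Φ (Q 0 *ᵥ u)) :
    ((∃ p : ℝ, 0 < p ∧ ErrorDecaysExponentially A H (gain H Q p)) → Detectable A H Q) ∧
    ((∀ j, ∃ c : ℝ, Filter.Tendsto (observability H Q j) Filter.atTop (nhds c)) →
      ((∃ p : ℝ, 0 < p ∧ ErrorDecaysExponentially A H (gain H Q p)) ↔ Detectable A H Q)) :=
  mainTheorem2_general hkd A H
    (hA.essBounded fun i j => (hAcont i j).aestronglyMeasurable measurableSet_Ici)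
    (hH.essBounded fun i j => (hHmeas i j).aestronglyMeasurable)
    Φ hΦ lam hlam hk QQ hQQ hreg Q hQlead hQ0
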